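/- \textbf{Model.} Let $\mathcal H,\mathcal Z$ be real separable Hilbert spaces and $A:\mathcal H\to\mathcal Z$ a Hilbert--Schmidt operator of infinite rank whose singular values $s_1\ge s_2\ge\dots>0$ satisfy $c_1 i^{-\beta}\le s_i\le c_2 i^{-\beta}$ for some $c_1,c_2>0$ and $\beta>1/2$; let $\alpha\in\mathbb R$. Let $\theta\sim\pi=\mathcal N_{\mathcal H}(0,I)$ and, given $\theta$, let $z_1,z_2,\dots$ be i.i.d. from $p_\theta=\mathcal N_{\mathcal Z}(A\theta,I)$, where $\mathcal N(0,I)$ is the iso-normal process; $\theta$ and $z$ are generalised vectors, represented by their coordinates in orthonormal bases of singular vectors of $A$. Let $\|\theta\|=\|(A^\top A)^{\alpha/2}\theta\|_{\mathcal H}$, $\|z\|_z=\|(AA^\top)^{(\alpha-1)/2}z\|_{\mathcal Z}$ (values in $[0,\infty]$), let $W_{2,\theta},W_{2,z}$ be the 2-Wasserstein distances for these norms, and for $j\ge1$ $$\mathcal A_j(\theta,z)=\theta+j^{-1}(A^\top A+j^{-1}I)^{-1}\nabla_\theta\log p_\theta(z),\qquad \nabla_\theta\log p_\theta(z)=A^\top(z-A\theta),\qquad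 \Delta_j(\theta,z)=\mathcal A_j(\theta,z)-\theta .$$ Write $\pi_j=\pi(\cdot\mid z_{1:j})$, $m_j$ for its mean, $\varepsilon_j^2=\mathbb E_\pi\,\mathbb E_{\theta\sim\pi_j}\|\theta-m_j\|^2$, where $\mathbb E_\pi$ is the expectation over $\theta_0\sim\pi$, $z_{1:j}\sim p_{\theta_0}^{\otimes j}$. Let $\tilde\theta_0=0$, $\tilde\theta_j=\mathcal A_j(\tilde\theta_{j-1},z_j)$, and $\bar\varepsilon_j^2=\mathbb E_\pi\|\tilde\theta_j-\theta_0\|^2-\varepsilon_j^2$ (with $\infty-\infty=0$). Given $z_{1:n}$, put $\hat\theta_n=\tilde\theta_n$ and, for $j\ge n$, $\hat z_{j+1}\sim p_{\hat\theta_j}$, $\hat\theta_{j+1}=\mathcal A_{j+1}(\hat\theta_j,\hat z_{j+1})$; for $n\le N<\infty$ let $\hat p_{n,N}$ be the law of $\hat\theta_N$ given $z_{1:n}$. \textbf{Claim.} There is a universal constant $C$ (independent of the spaces, $A$, $\alpha$, $\beta$, $n$, $N$) such that, with $\eta_j=j^{-1}$, the following hold. (1) \emph{Zero excess error.} For all $j\ge0$: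 $\tilde\theta_j=m_j$ almost surely, $\mathbb E_\pi\|\tilde\theta_j-\theta_0\|^2=\varepsilon_j^2$, and $\bar\varepsilon_j=0$. (2) For all $n\ge1$, $N\in\mathbb N\cup\{\infty\}$, $\delta>0$, $0<\iota\le1$, $0<s<\min\{\delta,\iota\}$ and every sequence $\nu_j\ge0$ with $\nu_j\to0$: (a) (approximate martingale) $\|\mathbb E_{z\sim p_\theta}\Delta_j(\theta,z)\|^2\le j^{-2(1+\delta)}\varepsilon_j^2$ for all $j\ge n$ and all $\theta$; (b) (stability I) for $n\le j<N$, $\eta_j\le j^{-(1+\iota)/2}$, $\|\Delta_j(\theta,z)-\Delta_j(\theta',z)\|^2\le\eta_j^2\|\theta-\theta'\|^2$ and $\|\Delta_j(\theta,z)-\Delta_j(\theta,z')\|^2\le\eta_j^2\|z-z'\|_z^2$ for all $\theta,\theta',z,z'$. Moreover, either $W_{2,z}^2(p_\theta,p_{\theta'})\le\|\theta-\theta'\|^2$ for all $\theta,\theta'$; or $W_{2,z}^2(p_\theta,p_{\theta'})\le\|\theta-\theta'\|$ for all $\theta,\theta'$ and $\eta_j\le j^{-(3+\iota)/4}$ for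 $n\le j<N$; (c) (efficiency) $\bar\varepsilon_j^2\le j^{-(1-\iota+s)}\nu_j\varepsilon_j^2$ for $n\le j\le N$; (d) (stability II, with constants $0$ and $1$) there are linear maps $H_{\theta,j}$ with $\|H_{\theta,j}x\|\le\|x\|$ for all $x$ such that $\|\mathbb E_{z'\sim p_{\theta'}}\Delta_{j+1}(\theta,z')-\eta_jH_{\theta,j}(\theta'-\theta)\|=0$ for all $\theta,\theta'$ and $j\ge1$. (3) If $2\alpha\beta>1$ (in particular if $\alpha=1$), then $\varepsilon_j<\infty$ for all $j\ge1$, and there is $n_0$ such that for all $n\ge n_0$ the remaining conditions hold for every $s\in\mathbb R$ and every sequence $\nu_j\ge0$: $\bar\varepsilon_j\le1$ and $\varepsilon_j\ge j^{-1}$ for $j\ge n$; $\varepsilon_j\to0$; $\bar\varepsilon_j$ is non-increasing; and $C_{\mathrm{alg}}\sum_{j\ge n}j^{1+s}\eta_j^2\varepsilon_j^4\le\nu_n\varepsilon_n^2$ with $C_{\mathrm{alg}}=0$. (4) For all $1\le n\le N<\infty$, $\ \mathbb E_\pi W_{2,\theta}^2(\pi_n,\hat p_{n,N})\le C\,\varepsilon_n^2/n+\varepsilon_N^2$.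 (5) If $2\alpha\beta>1$, then for every $n\ge1$ and every starting value $\hat\theta_n$, $\hat\theta_N$ converges almost surely in $\|\cdot\|$ to some $\hat\theta_\infty$ as $N\to\infty$; and the law $\hat p_{n,\infty}$ of $\hat\theta_\infty$ given $z_{1:n}$ satisfies $\mathbb E_\pi W_{2,\theta}^2(\pi_n,\hat p_{n,\infty})\le C\,\varepsilon_n^2/n$. -/

import Mathlib

open MeasureTheory ProbabilityTheory Filter Topology
open scoped ENNReal NNReal InnerProductSpace

noncomputable section

/-! ### Martingale posteriors

Parameters and observations are generalised vectors, given by their real coordinates: the parameter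
space is `I → ℝ` and the data space is `K → ℝ`, with `I`, `K` countable and the product
`σ`-algebras.  Expectations of random parameters are taken coordinate by coordinate.  Norms may
take the value `∞`. -/

theorem measurable_measure_pi_const {T Y : Type*} [MeasurableSpace T] [MeasurableSpace Y]
    (p : Kernel T Y) [IsMarkovKernel p] (j : ℕ) :
    Measurable fun θ => Measure.pi fun _ : Fin j => p θ := by
  refine Measurable.measure_of_isPiSystem_of_isProbabilityMeasure
    generateFrom_pi.symm isPiSystem_pi ?_
  rintro _ ⟨t, ht, rfl⟩
  simp only [Measure.pi_pi]
  exact Finset.measurable_prod _ fun i _ => p.measurable_coe (ht i (Set.mem_univ i))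

/-- The squared 2-Wasserstein distance with respect to the (semi-)norm `N`. -/
def wassersteinSq {X : Type*} [MeasurableSpace X] [Sub X] (N : X → ℝ≥0∞) (P Q : Measure X) :
    ℝ≥0∞ :=
  ⨅ γ ∈ {γ : Measure (X × X) | γ.map Prod.fst = P ∧ γ.map Prod.snd = Q},
    ∫⁻ x, N (x.1 - x.2) ^ 2 ∂γ

/-- A statistical model with a prior, an online algorithm, and (semi-)norms on parameters and
on data. -/
structure MPModel (I K : Type*) where
  /-- the prior `π` -/
  prior : Measure (I → ℝ)
  /-- the likelihood `θ ↦ p_θ` -/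
  lik : Kernel (I → ℝ) (K → ℝ)
  /-- the online algorithm `(θ, z) ↦ 𝒜_j(θ, z)` -/
  alg : ℕ → (I → ℝ) × (K → ℝ) → (I → ℝ)
  /-- the output of the algorithm before any observation -/
  init : I → ℝ
  /-- the norm on parameters in which errors are measured -/
  nrm : (I → ℝ) → ℝ≥0∞
  /-- the norm on the data space -/
  nrmZ : (K → ℝ) → ℝ≥0∞
  prior_prob : IsProbabilityMeasure prior
  lik_markov : IsMarkovKernel lik
  measurable_alg : ∀ j, Measurable (alg j)

namespace MPModel

variable {I K : Type*} (M : MPModel I K)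

instance : IsProbabilityMeasure M.prior := M.prior_prob

instance : IsMarkovKernel M.lik := M.lik_markov

/-- `θ ↦` law of `z_{1:j}`, i.i.d. from `p_θ`. -/
def sample (j : ℕ) : Kernel (I → ℝ) (Fin j → K → ℝ) where
  toFun θ := Measure.pi fun _ => M.lik θ
  measurable' := measurable_measure_pi_const M.lik j

instance (j : ℕ) : IsMarkovKernel (M.sample j) :=
  ⟨fun θ => by change IsProbabilityMeasure (Measure.pi fun _ => M.lik θ); infer_instance⟩

/-- The law of `z_{1:j}` under the prior predictive distribution. -/
def dataLaw (j : ℕ) : Measure (Fin j → K → ℝ) := M.sample j ∘ₘ M.prior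

/-- The posterior `π(· ∣ z_{1:j})`. -/
def post [Countable I] (j : ℕ) : Kernel (Fin j → K → ℝ) (I → ℝ) := (M.sample j)†M.prior

/-- The posterior mean given `z_{1:j}`. -/
def postMean [Countable I] (j : ℕ) (z : Fin j → K → ℝ) : I → ℝ := fun i => ∫ θ, θ i ∂M.post j z

/-- The squared radius `ε_j²` of the posterior. -/
def radiusSq [Countable I] (j : ℕ) : ℝ≥0∞ :=
  ∫⁻ θ₀, ∫⁻ z, ∫⁻ θ, M.nrm (θ - M.postMean j z) ^ 2 ∂M.post j z ∂M.sample j θ₀ ∂M.prior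

/-- The output of the algorithm applied successively to `z_1, …, z_j`. -/
def estimate : (j : ℕ) → (Fin j → K → ℝ) → (I → ℝ)
  | 0, _ => M.init
  | j + 1, z => M.alg (j + 1) (estimate j (Fin.init z), z (Fin.last j))

/-- The mean squared error of the algorithm on tasks drawn from the prior. -/
def risk (j : ℕ) : ℝ≥0∞ :=
  ∫⁻ θ₀, ∫⁻ z, M.nrm (M.estimate j z - θ₀) ^ 2 ∂M.sample j θ₀ ∂M.prior

/-- The squared excess error of the algorithm. -/
def excessSq [Countable I] (j : ℕ) : ℝ≥0∞ := M.risk j - M.radiusSq j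

/-- `Δ_j(θ, z) = 𝒜_j(θ, z) - θ`. -/
def incr (j : ℕ) (θ : I → ℝ) (z : K → ℝ) : I → ℝ := M.alg j (θ, z) - θ

/-- `𝔼_{z ∼ p_θ'} Δ_j(θ, z)`. -/
def meanIncr (j : ℕ) (θ' θ : I → ℝ) : I → ℝ := fun i => ∫ z, M.incr j θ z i ∂M.lik θ'

/-- One imputation step: `ẑ ∼ p_θ`, then `θ` is replaced by `𝒜_j(θ, ẑ)`. -/
def stepKernel (j : ℕ) : Kernel (I → ℝ) (I → ℝ) := (Kernel.id ×ₖ M.lik).map (M.alg j)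

instance (j : ℕ) : IsMarkovKernel (M.stepKernel j) :=
  Kernel.IsMarkovKernel.map _ (M.measurable_alg j)

/-- The law of the sequence `(θ̂_n, θ̂_{n+1}, …)` obtained by `ẑ_{j+1} ∼ p_{θ̂_j}`,
`θ̂_{j+1} = 𝒜_{j+1}(θ̂_j, ẑ_{j+1})`, started at `θ̂_n = θ`; entry `k` is `θ̂_{n+k}`. -/
def mpPath (n : ℕ) (θ : I → ℝ) : Measure (ℕ → I → ℝ) :=
  Kernel.traj (X := fun _ => I → ℝ)
    (fun k => (M.stepKernel (n + k + 1)).comap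
      (fun h : (i : Finset.Iic k) → I → ℝ => h ⟨k, Finset.mem_Iic.2 le_rfl⟩)
      (measurable_pi_apply _)) 0 (fun _ => θ)

/-- The martingale posterior given `z_{1:n}`, truncated at `N ≥ n`: the conditional law
of `θ̂_N`, where `θ̂_n` is the output of the algorithm on `z_{1:n}`. -/
def mpLaw (n N : ℕ) (z : Fin n → K → ℝ) : Measure (I → ℝ) :=
  (M.mpPath n (M.estimate n z)).map fun x => x (N - n)

/-- The limit `θ̂_∞` of a sequence of parameters. -/
def pathLimit (x : ℕ → I → ℝ) : I → ℝ := fun i => limUnder atTop fun k => x k i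

/-- The martingale posterior without truncation: the conditional law of `θ̂_∞`. -/
def mpLawInf (n : ℕ) (z : Fin n → K → ℝ) : Measure (I → ℝ) :=
  (M.mpPath n (M.estimate n z)).map pathLimit

/-- The average over tasks and data of the squared 2-Wasserstein distance between the posterior
and `Q(z_{1:n})`. -/
def meanDistSq [Countable I] (n : ℕ) (Q : (Fin n → K → ℝ) → Measure (I → ℝ)) : ℝ≥0∞ :=
  ∫⁻ θ₀, ∫⁻ z, wassersteinSq M.nrm (M.post n z) (Q z) ∂M.sample n θ₀ ∂M.prior

/-- The algorithm defines an approximate martingale. -/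
def ApproxMartingale [Countable I] (n : ℕ) (δ : ℝ) : Prop :=
  0 < δ ∧ ∀ j, n ≤ j → ∀ θ,
    (∀ i, Integrable (fun z => M.incr j θ z i) (M.lik θ)) ∧
    M.nrm (M.meanIncr j θ θ) ^ 2 ≤ ENNReal.ofReal ((j : ℝ) ^ (-2 * (1 + δ))) * M.radiusSq j

/-- First stability condition; `N = ∞` is allowed. -/
def StabilityI (n : ℕ) (N : ℕ∞) (η : ℕ → ℝ) (ι L₁ L₂ CΘ : ℝ) : Prop :=
  0 < ι ∧ 0 < L₁ ∧ 0 < L₂ ∧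
  (∀ j : ℕ, n ≤ j → (j : ℕ∞) < N →
    0 ≤ η j ∧ η j ≤ (j : ℝ) ^ (-(1 + ι) / 2) ∧
    (∀ θ θ' z, M.nrm (M.incr j θ z - M.incr j θ' z) ^ 2
      ≤ ENNReal.ofReal (η j ^ 2 * L₁ ^ 2) * M.nrm (θ - θ') ^ 2) ∧
    (∀ θ z z', M.nrm (M.incr j θ z - M.incr j θ z') ^ 2
      ≤ ENNReal.ofReal (η j ^ 2 * L₂ ^ 2) * M.nrmZ (z - z') ^ 2)) ∧
  ((∀ θ θ', wassersteinSq M.nrmZ (M.lik θ) (M.lik θ')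
      ≤ ENNReal.ofReal CΘ * M.nrm (θ - θ') ^ 2) ∨
   ((∀ θ θ', wassersteinSq M.nrmZ (M.lik θ) (M.lik θ')
      ≤ ENNReal.ofReal CΘ * M.nrm (θ - θ')) ∧
    ∀ j : ℕ, n ≤ j → (j : ℕ∞) < N → η j ≤ (j : ℝ) ^ (-(3 + ι) / 4)))

/-- The algorithm is efficient up to sample size `N`; `N = ∞` is allowed. -/
def Efficiency [Countable I] (n : ℕ) (N : ℕ∞) (δ ι s : ℝ) (ν : ℕ → ℝ≥0) : Prop :=
  0 < s ∧ s < min δ ι ∧ Tendsto ν atTop (𝓝 0) ∧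
  ∀ j : ℕ, n ≤ j → (j : ℕ∞) ≤ N →
    M.excessSq j ≤ ENNReal.ofReal ((j : ℝ) ^ (-(1 - ι + s))) * ν j * M.radiusSq j

/-- Second stability condition.  The operator norm of `H θ j` is the one induced by `M.nrm`. -/
def StabilityII (η : ℕ → ℝ) (Calg Calg' : ℝ) : Prop :=
  0 ≤ Calg ∧ 0 ≤ Calg' ∧
  ∃ H : (I → ℝ) → ℕ → (I → ℝ) →ₗ[ℝ] (I → ℝ),
    ∀ θ θ' : I → ℝ, ∀ j : ℕ, 1 ≤ j →
      (∀ i, Integrable (fun z => M.incr (j + 1) θ z i) (M.lik θ')) ∧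
      M.nrm (M.meanIncr (j + 1) θ' θ - η j • H θ j (θ' - θ))
        ≤ ENNReal.ofReal (Calg * η j) * M.nrm (θ' - θ) ^ 2 ∧
      ∀ x, M.nrm (H θ j x) ^ 2 ≤ ENNReal.ofReal Calg' * M.nrm x ^ 2

/-- Miscellaneous conditions on the posterior radius and the excess error. -/
def Regularity [Countable I] (n : ℕ) (η : ℕ → ℝ) (s Calg : ℝ) (ν : ℕ → ℝ≥0) : Prop :=
  (∀ j, n ≤ j → M.excessSq j ≤ 1 ∧ ENNReal.ofReal (((j : ℝ)⁻¹) ^ 2) ≤ M.radiusSq j) ∧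
  Tendsto M.radiusSq atTop (𝓝 0) ∧
  Antitone M.excessSq ∧
  ENNReal.ofReal Calg * ∑' j : Set.Ici n,
      ENNReal.ofReal ((j : ℝ) ^ (1 + s) * η j ^ 2) * M.radiusSq j ^ 2 ≤ ν n * M.radiusSq n

end MPModel

/-! ### The linear-Gaussian inverse problem -/

section LinearGaussian

set_option linter.unusedSectionVars false

variable {H Z : Type*} [NormedAddCommGroup H] [InnerProductSpace ℝ H] [CompleteSpace H]
  [NormedAddCommGroup Z] [InnerProductSpace ℝ Z] [CompleteSpace Z]

/-- The action of a bounded operator `T` on generalised vectors `x`, in coordinates with respect to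
orthonormal bases. -/
def opCoord {I K E F : Type*} [NormedAddCommGroup E] [InnerProductSpace ℝ E]
    [NormedAddCommGroup F] [InnerProductSpace ℝ F]
    (v : HilbertBasis I ℝ E) (u : HilbertBasis K ℝ F) (T : E →L[ℝ] F) (x : I → ℝ) : K → ℝ :=
  fun k => ∑' i, ⟪u k, T (v i)⟫_ℝ * x i

/-- On genuine vectors `opCoord` is the operator itself. -/
theorem opCoord_coords {I K : Type*} (v : HilbertBasis I ℝ H) (u : HilbertBasis K ℝ Z)
    (T : H →L[ℝ] Z) (x : H) :
    opCoord v u T (fun i => ⟪v i, x⟫_ℝ) = fun k => ⟪u k, T x⟫_ℝ := by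
  funext k
  have h := v.tsum_inner_mul_inner (T.adjoint (u k)) x
  simp only [ContinuousLinearMap.adjoint_inner_left] at h
  exact h

theorem measurable_opCoord {I K E F : Type*} [Countable I]
    [NormedAddCommGroup E] [InnerProductSpace ℝ E] [NormedAddCommGroup F] [InnerProductSpace ℝ F]
    (v : HilbertBasis I ℝ E) (u : HilbertBasis K ℝ F) (T : E →L[ℝ] F) :
    Measurable (opCoord v u T) :=
  measurable_pi_lambda _ fun _ =>
    Measurable.tsum fun i => measurable_const.mul (measurable_pi_apply i)

/-- The law of the iso-normal process, in coordinates with respect to an orthonormal basis indexed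
by `I`: the coordinates are independent standard Gaussian variables. -/
def isoNormal (I : Type*) : Measure (I → ℝ) := Measure.infinitePi fun _ => gaussianReal 0 1

instance (I : Type*) : IsProbabilityMeasure (isoNormal I) := by
  unfold isoNormal; infer_instance

/-- A singular value decomposition of an operator `A` of infinite rank: the singular values, in
nonincreasing order, and singular vectors completed to orthonormal bases of `H` and `Z`. -/
structure SingularSystem (A : H →L[ℝ] Z) (P Q : Type*) where
  s : ℕ → ℝ
  v : HilbertBasis (ℕ ⊕ P) ℝ H
  u : HilbertBasis (ℕ ⊕ Q) ℝ Z
  s_pos : ∀ i, 0 < s i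
  s_anti : Antitone s
  map_inl : ∀ i, A (v (Sum.inl i)) = s i • u (Sum.inl i)
  map_inr : ∀ k, A (v (Sum.inr k)) = 0

/-- The norm `‖D^a x‖` of a generalised vector `x`, where `D` is the nonnegative diagonal operator
with eigenvalues `s_0, s_1, …` and `0`.  For negative `a` it is infinite
unless `x` vanishes on the kernel of `D`. -/
def diagNorm {P : Type*} (s : ℕ → ℝ) (a : ℝ) (x : ℕ ⊕ P → ℝ) : ℝ≥0∞ :=
  (∑' i, ENNReal.ofReal (Sum.elim s (fun _ => 0) i) ^ (2 * a) * ENNReal.ofReal (x i ^ 2))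
    ^ (1 / 2 : ℝ)

namespace SingularSystem

variable {A : H →L[ℝ] Z} {P Q : Type*} (S : SingularSystem A P Q)

/-- `θ ↦ A θ`. -/
def fwd (θ : ℕ ⊕ P → ℝ) : ℕ ⊕ Q → ℝ := opCoord S.v S.u A θ

/-- `z ↦ Aᵀ z`. -/
def bwd (z : ℕ ⊕ Q → ℝ) : ℕ ⊕ P → ℝ := opCoord S.u S.v A.adjoint z

end SingularSystem

/-- The preconditioner `(Aᵀ A + j⁻¹ I)⁻¹`. -/
def precond (A : H →L[ℝ] Z) (j : ℕ) : H →L[ℝ] H :=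
  Ring.inverse (A.adjoint ∘L A + (j : ℝ)⁻¹ • ContinuousLinearMap.id ℝ H)

/-- The log-likelihood of `θ ∈ H` for the observation `z`, relative to the law of pure noise, is
`⟪z, A θ⟫ - ‖A θ‖² / 2`, and its gradient is `Aᵀ (z - A θ)`. -/
theorem hasGradientAt_logLikelihood (A : H →L[ℝ] Z) (z : Z) (θ : H) :
    HasGradientAt (fun ϑ : H => ⟪z, A ϑ⟫_ℝ - ‖A ϑ‖ ^ 2 / 2) (A.adjoint (z - A θ)) θ := by
  rw [hasGradientAt_iff_hasFDerivAt]
  have hA : HasFDerivAt (fun ϑ : H => A ϑ) A θ := A.hasFDerivAt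
  have h1 := (hasFDerivAt_const z θ).inner ℝ hA
  have h2 := (hA.norm_sq).mul_const (2 : ℝ)⁻¹
  simp only [div_eq_mul_inv]
  refine (h1.sub h2).congr_fderiv ?_
  ext w
  simp [ContinuousLinearMap.adjoint_inner_left]

namespace SingularSystem

variable {A : H →L[ℝ] Z} {P Q : Type*} (S : SingularSystem A P Q)

/-- `∇ log p(z; θ) = Aᵀ (z - A θ)`. -/
def score (θ : ℕ ⊕ P → ℝ) (z : ℕ ⊕ Q → ℝ) : ℕ ⊕ P → ℝ := S.bwd (z - S.fwd θ)

/-- `𝒜_j(θ, z) = θ + j⁻¹ (Aᵀ A + j⁻¹ I)⁻¹ ∇ log p(z; θ)`. -/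
def update (j : ℕ) (x : (ℕ ⊕ P → ℝ) × (ℕ ⊕ Q → ℝ)) : ℕ ⊕ P → ℝ :=
  x.1 + (j : ℝ)⁻¹ • opCoord S.v S.v (precond A j) (S.score x.1 x.2)

theorem measurable_fwd [Countable P] : Measurable S.fwd := measurable_opCoord _ _ _

theorem measurable_bwd [Countable Q] : Measurable S.bwd := measurable_opCoord _ _ _

variable [Countable P] [Countable Q]

theorem measurable_update (j : ℕ) : Measurable (S.update j) := by
  have h : Measurable fun x : (ℕ ⊕ P → ℝ) × (ℕ ⊕ Q → ℝ) => S.score x.1 x.2 :=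
    S.measurable_bwd.comp (measurable_snd.sub (S.measurable_fwd.comp measurable_fst))
  have h' : Measurable fun x : (ℕ ⊕ P → ℝ) × (ℕ ⊕ Q → ℝ) =>
      opCoord S.v S.v (precond A j) (S.score x.1 x.2) :=
    (measurable_opCoord S.v S.v (precond A j)).comp h
  exact measurable_fst.add (h'.const_smul ((j : ℝ)⁻¹))

/-- The model `z ∣ θ ∼ 𝒩(A θ, I)` with prior `𝒩(0, I)`, the norms `‖(Aᵀ A)^{α/2} θ‖` and
`‖(A Aᵀ)^{(α-1)/2} z‖`, and the preconditioned update started from the prior mean. -/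
def model (α : ℝ) : MPModel (ℕ ⊕ P) (ℕ ⊕ Q) where
  prior := isoNormal (ℕ ⊕ P)
  lik := (Kernel.id ×ₖ Kernel.const _ (isoNormal (ℕ ⊕ Q))).map fun x => S.fwd x.1 + x.2
  alg := S.update
  init := 0
  nrm := diagNorm S.s α
  nrmZ := diagNorm S.s (α - 1)
  prior_prob := inferInstance
  lik_markov := Kernel.IsMarkovKernel.map _
    ((S.measurable_fwd.comp measurable_fst).add measurable_snd)
  measurable_alg := S.measurable_update

end SingularSystem

end LinearGaussian

end

/-! In the singular bases everything is diagonal. For singular value `w` the update is `θ + g (z - w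
θ)` with gain `g = w V_j`, where `V_j = 1 / (1 + j w²)` is the conjugate posterior variance. This is
the scalar Kalman filter, so started from the prior mean it reproduces the posterior mean exactly
and the excess error vanishes. `exists_predict` and `lintegral_prior_sample` prove this without
densities: a rotation of independent Gaussians separates the innovation, which alone determines the
new observation, from the residual, which remains standard normal. Induction disintegrates the joint
law, and uniqueness of disintegrations gives `post_ae_eq`.

The stability conditions reduce to `0 ≤ g w ≤ 1 / j`. The mean increment is `g w (θ' - θ)`, so the
martingale property and the linearity of the drift are exact.

Under imputation the innovation is pure noise. Given the data, the imputed parameter is therefore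
Gaussian around the estimate, with variance `∑ g²`. Since `V_m - V_{m+1} = w² V_m V_{m+1}` and
`g_{m+1}² = w² V_{m+1}²`, each step loses at most a fraction `1 / n` of the decrease in posterior
variance (`postVar_sub_succ`). The losses telescope, and driving both Gaussians by the same noise,
with `(√a - √b)² ≤ a - b`, gives the Wasserstein bounds with `C = 1`.

For the infinite horizon, coordinates converge as `L²`-bounded martingales. Doob's inequality for
weighted sums of squared increments controls all coordinates at once: the remaining variance after
time `m` is at most `ε_m²`, which tends to zero when `∑ s_i^(2α)` is finite. -/

noncomputable section

/-! ### Standard Gaussian sequences -/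

/-- The rotation in the plane taking `(x, y)` to `(c x + d y, c y - d x)`. -/
def planeRot (c d : ℝ) (p : ℝ × ℝ) : ℝ × ℝ := (c * p.1 + d * p.2, c * p.2 - d * p.1)

theorem measurable_planeRot (c d : ℝ) : Measurable (planeRot c d) := by
  unfold planeRot; fun_prop

/-- A unit vector with `d ≥ 0` is `(cos, sin)` of `arccos c`, so rotation invariance of centred
Gaussians applies. -/
theorem map_planeRot_gaussianReal {c d : ℝ} (hd : 0 ≤ d) (hcd : c ^ 2 + d ^ 2 = 1) :
    ((gaussianReal 0 1).prod (gaussianReal 0 1)).map (planeRot c d)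
      = (gaussianReal 0 1).prod (gaussianReal 0 1) := by
  have h := IsGaussian.map_rotation_eq_self (μ := gaussianReal 0 1) (by simp) (Real.arccos c)
  have hc : Real.cos (Real.arccos c) = c := Real.cos_arccos (by nlinarith) (by nlinarith)
  have hs : Real.sin (Real.arccos c) = d := by
    rw [Real.sin_arccos, show 1 - c ^ 2 = d ^ 2 by linarith, Real.sqrt_sq hd]
  convert! h using 2
  ext p <;> simp [planeRot, ContinuousLinearMap.rotation_apply, hc, hs]
  ring

/-- A sequence of pairs as a pair of sequences. -/
def unzip {L : Type*} (q : L → ℝ × ℝ) : (L → ℝ) × (L → ℝ) := (fun l => (q l).1, fun l => (q l).2)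

theorem measurable_unzip {L : Type*} : Measurable (unzip (L := L)) := by
  unfold unzip; fun_prop

/-- Both sides are one Gaussian family over `L` and `Bool`, curried in the two possible orders;
`Bool` turns binary products into infinite ones. -/
theorem map_unzip_infinitePi (L : Type*) :
    (Measure.infinitePi fun _ : L => (gaussianReal 0 1).prod (gaussianReal 0 1)).map unzip
      = (isoNormal L).prod (isoNormal L) := by
  have hG : (gaussianReal 0 1).prod (gaussianReal 0 1)
      = (Measure.infinitePi fun _ : Bool => gaussianReal 0 1).map fun ω => (ω false, ω true) :=
    (Measure.infinitePi_map_eval_prod (P := fun _ : Bool => gaussianReal 0 1) (by simp)).symm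
  have hI : (isoNormal L).prod (isoNormal L)
      = (Measure.infinitePi fun _ : Bool => isoNormal L).map fun ω => (ω false, ω true) :=
    (Measure.infinitePi_map_eval_prod (P := fun _ : Bool => isoNormal L) (by simp)).symm
  have hB := Measure.infinitePi_map_curry (fun (_ : Bool) (_ : L) => gaussianReal 0 1)
  have hL := Measure.infinitePi_map_curry (fun (_ : L) (_ : Bool) => gaussianReal 0 1)
  have hS := Measure.map_infinitePi_infinitePi_of_inj (P := fun _ : Bool × L => gaussianReal 0 1)
    (Prod.swap_injective (α := L) (β := Bool))
  have hP := Measure.infinitePi_map_pi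
    (μ := fun _ : L => Measure.infinitePi fun _ : Bool => gaussianReal 0 1)
    (f := fun _ ω => (ω false, ω true)) (fun _ => by fun_prop)
  simp only [hG, hI]
  rw [← hP, ← hL, ← hS]
  unfold isoNormal
  rw [← hB, Measure.map_map, Measure.map_map, Measure.map_map, Measure.map_map]
  · rfl
  all_goals first
    | fun_prop
    | exact measurable_unzip
    | exact (measurable_unzip.comp (by fun_prop)).comp (MeasurableEquiv.measurable _)
    | exact measurable_unzip.comp (by fun_prop)

/-- The rotation of the planes spanned by corresponding coordinates of two sequences. -/
def seqRot {L : Type*} (c d : L → ℝ) (p : (L → ℝ) × (L → ℝ)) : (L → ℝ) × (L → ℝ) :=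
  (fun l => c l * p.1 l + d l * p.2 l, fun l => c l * p.2 l - d l * p.1 l)

theorem measurable_seqRot {L : Type*} (c d : L → ℝ) : Measurable (seqRot c d) := by
  unfold seqRot; fun_prop

theorem map_seqRot_isoNormal {L : Type*} {c d : L → ℝ} (hd : ∀ l, 0 ≤ d l)
    (hcd : ∀ l, c l ^ 2 + d l ^ 2 = 1) :
    ((isoNormal L).prod (isoNormal L)).map (seqRot c d) = (isoNormal L).prod (isoNormal L) := by
  have hP := Measure.infinitePi_map_pi
    (μ := fun _ : L => (gaussianReal 0 1).prod (gaussianReal 0 1))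
    (f := fun l => planeRot (c l) (d l)) (fun l => measurable_planeRot _ _)
  simp only [map_planeRot_gaussianReal (hd _) (hcd _)] at hP
  conv_rhs => rw [← map_unzip_infinitePi, ← hP]
  rw [← map_unzip_infinitePi, Measure.map_map (measurable_seqRot c d) measurable_unzip,
    Measure.map_map measurable_unzip]
  · rfl
  · exact measurable_pi_lambda _ fun l => (measurable_planeRot _ _).comp (measurable_pi_apply l)

/-- Polar coordinates of `(a, b)`; at the origin any direction serves, and `(1, 0)` is chosen. -/
theorem exists_sqrt_mul_eq {a b : ℝ} (hb : 0 ≤ b) :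
    ∃ c d : ℝ, 0 ≤ d ∧ c ^ 2 + d ^ 2 = 1 ∧ √(a ^ 2 + b ^ 2) * c = a ∧ √(a ^ 2 + b ^ 2) * d = b := by
  rcases eq_or_ne (a ^ 2 + b ^ 2) 0 with h | h
  · have ha : a = 0 := by nlinarith [sq_nonneg a, sq_nonneg b]
    have hb : b = 0 := by nlinarith [sq_nonneg a, sq_nonneg b]
    exact ⟨1, 0, le_rfl, by simp, by simp [ha, hb], by simp [ha, hb]⟩
  · have hp : 0 < a ^ 2 + b ^ 2 := lt_of_le_of_ne (by positivity) h.symm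
    have hs : 0 < √(a ^ 2 + b ^ 2) := Real.sqrt_pos.2 hp
    refine ⟨a / √(a ^ 2 + b ^ 2), b / √(a ^ 2 + b ^ 2), by positivity, ?_, by field_simp,
      by field_simp⟩
    rw [div_pow, div_pow, Real.sq_sqrt hp.le, ← add_div, div_self h]

/-- Sums of independent rescaled standard Gaussian sequences. -/
theorem map_mul_add_mul_isoNormal {L : Type*} (a b : L → ℝ) (hb : ∀ l, 0 ≤ b l) :
    ((isoNormal L).prod (isoNormal L)).map (fun p l => a l * p.1 l + b l * p.2 l)
      = (isoNormal L).map fun x l => √(a l ^ 2 + b l ^ 2) * x l := by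
  choose c d hd hcd hc hs using fun l => exists_sqrt_mul_eq (a := a l) (hb l)
  have h := map_seqRot_isoNormal hd hcd
  have h1 : ((isoNormal L).prod (isoNormal L)).map Prod.fst = isoNormal L := by simp
  -- The right side uses one sequence only; it is realised as the first component of the rotated
  -- pair.
  conv_rhs => rw [← h1, ← h]
  rw [Measure.map_map measurable_fst (measurable_seqRot c d), Measure.map_map (by fun_prop)
    (measurable_fst.comp (measurable_seqRot c d))]
  congr 1
  funext p l
  simp only [Function.comp, seqRot]
  linear_combination (-p.1 l) * hc l - p.2 l * hs l

theorem map_comp_isoNormal {I L : Type*} {f : I → L} (hf : Function.Injective f) :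
    (isoNormal L).map (fun x i => x (f i)) = isoNormal I :=
  Measure.map_infinitePi_infinitePi_of_inj (P := fun _ => gaussianReal 0 1) hf

/-! ### Gaussian sequences on different index sets with common coordinates -/

section SharedCoordinates

variable {P Q : Type*}

/-- The sequence `z` with the coordinates indexed by `Q` replaced by zeros indexed by `P`. -/
def transfer (P : Type*) {Q : Type*} (z : ℕ ⊕ Q → ℝ) : ℕ ⊕ P → ℝ :=
  Sum.elim (fun i => z (Sum.inl i)) fun _ => 0

@[simp] theorem transfer_inl (z : ℕ ⊕ Q → ℝ) (i : ℕ) :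
    transfer P z (Sum.inl i) = z (Sum.inl i) := rfl

@[simp] theorem transfer_inr (z : ℕ ⊕ Q → ℝ) (p : P) : transfer P z (Sum.inr p) = 0 := rfl

theorem measurable_transfer : Measurable (transfer P (Q := Q)) :=
  measurable_pi_lambda _ fun i => by
    rcases i with i | p
    · exact measurable_pi_apply _
    · exact measurable_const

/-- Both noises are restrictions of a single one on `ℕ ⊕ (P ⊕ Q)`, and `g` removes every coordinate
in which they differ. -/
theorem map_mul_transfer_isoNormal (g : ℕ ⊕ P → ℝ) (hg : ∀ p, g (Sum.inr p) = 0) :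
    (isoNormal (ℕ ⊕ Q)).map (fun y i => g i * transfer P y i)
      = (isoNormal (ℕ ⊕ P)).map fun x i => g i * x i := by
  have hQ := map_comp_isoNormal (f := (Sum.map id Sum.inr : ℕ ⊕ Q → ℕ ⊕ (P ⊕ Q)))
    (Function.injective_id.sumMap Sum.inr_injective)
  have hP := map_comp_isoNormal (f := (Sum.map id Sum.inl : ℕ ⊕ P → ℕ ⊕ (P ⊕ Q)))
    (Function.injective_id.sumMap Sum.inl_injective)
  rw [← hQ, ← hP, Measure.map_map, Measure.map_map (by fun_prop) (by fun_prop)]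
  · congr 1
    funext x i
    rcases i with i | p <;> simp [hg]
  · exact measurable_pi_lambda _ fun i =>
      ((measurable_pi_apply i).comp measurable_transfer).const_mul _
  · fun_prop

/-- The rotation of the planes spanned by the coordinates of two sequences with a common index in
`ℕ`. -/
def sharedRot (c d : ℕ → ℝ) (p : (ℕ ⊕ Q → ℝ) × (ℕ ⊕ P → ℝ)) : (ℕ ⊕ Q → ℝ) × (ℕ ⊕ P → ℝ) :=
  (Sum.elim (fun i => c i * p.1 (Sum.inl i) + d i * p.2 (Sum.inl i)) fun q => p.1 (Sum.inr q),
    Sum.elim (fun i => c i * p.2 (Sum.inl i) - d i * p.1 (Sum.inl i)) fun q => p.2 (Sum.inr q))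

theorem measurable_sharedRot (c d : ℕ → ℝ) : Measurable (sharedRot c d (P := P) (Q := Q)) := by
  refine Measurable.prodMk ?_ ?_ <;> refine measurable_pi_lambda _ fun i => ?_ <;>
    rcases i with i | i <;> simp only [Sum.elim_inl, Sum.elim_inr] <;> fun_prop

theorem map_sharedRot_isoNormal {c d : ℕ → ℝ} (hd : ∀ l, 0 ≤ d l)
    (hcd : ∀ l, c l ^ 2 + d l ^ 2 = 1) :
    ((isoNormal (ℕ ⊕ Q)).prod (isoNormal (ℕ ⊕ P))).map (sharedRot c d)
      = (isoNormal (ℕ ⊕ Q)).prod (isoNormal (ℕ ⊕ P)) := by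
  have hQ := map_comp_isoNormal (f := (Sum.map id Sum.inr : ℕ ⊕ Q → ℕ ⊕ (P ⊕ Q)))
    (Function.injective_id.sumMap Sum.inr_injective)
  have hP := map_comp_isoNormal (f := (Sum.map id Sum.inl : ℕ ⊕ P → ℕ ⊕ (P ⊕ Q)))
    (Function.injective_id.sumMap Sum.inl_injective)
  -- On the enlarged index set the planes outside `ℕ` are rotated by angle zero, that is, left
  -- alone.
  have hR := map_seqRot_isoNormal (L := ℕ ⊕ (P ⊕ Q)) (c := Sum.elim c fun _ => 1)
    (d := Sum.elim d fun _ => 0) (by rintro (l | l) <;> simp [hd])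
    (by rintro (l | l) <;> simp [hcd])
  rw [← hQ, ← hP, Measure.map_prod_map _ _ (by fun_prop) (by fun_prop)]
  conv_rhs => rw [← hR]
  rw [Measure.map_map (measurable_sharedRot c d) (by fun_prop),
    Measure.map_map (by fun_prop) (measurable_seqRot _ _)]
  congr 1
  funext x
  refine Prod.ext (funext fun i => ?_) (funext fun i => ?_) <;> rcases i with i | i <;>
    simp [sharedRot, seqRot]

end SharedCoordinates

/-! ### The model in coordinates -/

section Coordinates

set_option linter.unusedSectionVars false

variable {H Z : Type*} [NormedAddCommGroup H] [InnerProductSpace ℝ H] [CompleteSpace H]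
  [NormedAddCommGroup Z] [InnerProductSpace ℝ Z] [CompleteSpace Z]

/-- The operator is coercive: its quadratic form is `‖A x‖² + r ‖x‖²`. -/
theorem isUnit_adjoint_comp_self_add_smul (A : H →L[ℝ] Z) {r : ℝ} (hr : 0 < r) :
    IsUnit (A.adjoint ∘L A + r • ContinuousLinearMap.id ℝ H) := by
  refine ContinuousLinearMap.isUnit_of_forall_le_norm_inner_map _ (c := ⟨r, hr.le⟩) hr fun x => ?_
  have h : ⟪(A.adjoint ∘L A + r • ContinuousLinearMap.id ℝ H) x, x⟫_ℝ
      = ‖A x‖ ^ 2 + r * ‖x‖ ^ 2 := by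
    simp [inner_add_left, inner_smul_left, ContinuousLinearMap.adjoint_inner_left]
  rw [h, Real.norm_of_nonneg (by positivity)]
  change ‖x‖ ^ 2 * r ≤ _
  nlinarith [sq_nonneg ‖A x‖]

/-- Eigenvectors are inherited by the inverse. Invertibility is essential because `Ring.inverse` is
zero on non-units, and `1 ≤ j` keeps the shift `j⁻¹` positive. -/
theorem precond_apply_eq {A : H →L[ℝ] Z} {j : ℕ} (hj : 1 ≤ j) {x : H} {μ : ℝ} (hμ : 0 ≤ μ)
    (hx : A.adjoint (A x) = μ • x) : precond A j x = (μ + (j : ℝ)⁻¹)⁻¹ • x := by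
  have hj' : (0 : ℝ) < (j : ℝ)⁻¹ := by positivity
  have h := Ring.inverse_mul_cancel _ (isUnit_adjoint_comp_self_add_smul A hj')
  have h1 := congrArg (fun T : H →L[ℝ] H => T x) h
  have h2 : (A.adjoint ∘L A + (j : ℝ)⁻¹ • ContinuousLinearMap.id ℝ H) x = (μ + (j : ℝ)⁻¹) • x := by
    simp [hx, add_smul]
  simp only [mul_apply_eq_comp, h2, map_smul, one_apply_eq_self] at h1
  rw [eq_inv_smul_iff₀ (by positivity)]
  exact h1

theorem opCoord_apply_of_eq_single {I K E F : Type*} [NormedAddCommGroup E]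
    [InnerProductSpace ℝ E] [NormedAddCommGroup F] [InnerProductSpace ℝ F]
    (v : HilbertBasis I ℝ E) (u : HilbertBasis K ℝ F) (T : E →L[ℝ] F) (x : I → ℝ) {i : I} {k : K}
    (h : ∀ i', i' ≠ i → ⟪u k, T (v i')⟫_ℝ = 0) :
    opCoord v u T x k = ⟪u k, T (v i)⟫_ℝ * x i :=
  tsum_eq_single i fun i' hi => by rw [h i' hi, zero_mul]

theorem opCoord_apply_eq_zero {I K E F : Type*} [NormedAddCommGroup E]
    [InnerProductSpace ℝ E] [NormedAddCommGroup F] [InnerProductSpace ℝ F]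
    (v : HilbertBasis I ℝ E) (u : HilbertBasis K ℝ F) (T : E →L[ℝ] F) (x : I → ℝ) {k : K}
    (h : ∀ i, ⟪u k, T (v i)⟫_ℝ = 0) : opCoord v u T x k = 0 := by
  simp [opCoord, h]

theorem HilbertBasis.inner_eq_zero_of_ne {I E : Type*} [NormedAddCommGroup E] [InnerProductSpace ℝ E]
    (v : HilbertBasis I ℝ E) {i j : I} (h : i ≠ j) : ⟪v i, v j⟫_ℝ = 0 :=
  v.orthonormal.inner_eq_zero h

theorem HilbertBasis.inner_self_eq_one {I E : Type*} [NormedAddCommGroup E] [InnerProductSpace ℝ E]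
    (v : HilbertBasis I ℝ E) (i : I) : ⟪v i, v i⟫_ℝ = 1 := by
  rw [real_inner_self_eq_norm_sq, v.orthonormal.norm_eq_one, one_pow]

namespace SingularSystem

variable {A : H →L[ℝ] Z} {P Q : Type*} (S : SingularSystem A P Q)

/-- The singular values, indexed by the basis of the parameter space. -/
def weight : ℕ ⊕ P → ℝ := Sum.elim S.s fun _ => 0

@[simp] theorem weight_inl (i : ℕ) : S.weight (Sum.inl i) = S.s i := rfl

@[simp] theorem weight_inr (p : P) : S.weight (Sum.inr p) = 0 := rfl

theorem weight_nonneg (i : ℕ ⊕ P) : 0 ≤ S.weight i := by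
  rcases i with i | p
  · exact (S.s_pos i).le
  · exact le_rfl

theorem inner_map_inl (k : ℕ ⊕ Q) (i : ℕ) :
    ⟪S.u k, A (S.v (Sum.inl i))⟫_ℝ = S.s i * ⟪S.u k, S.u (Sum.inl i)⟫_ℝ := by
  rw [S.map_inl, inner_smul_right]

/-- A singular system prescribes only `A`, so the adjoint is recovered by testing against the basis
`v`. -/
theorem adjoint_map (i : ℕ ⊕ P) : A.adjoint (A (S.v i)) = S.weight i ^ 2 • S.v i := by
  rcases i with i | p
  · refine S.v.repr.injective (lp.ext (funext fun k => ?_))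
    rw [S.v.repr_apply_apply, S.v.repr_apply_apply, ContinuousLinearMap.adjoint_inner_right,
      inner_smul_right, weight_inl]
    rcases k with k | p
    · rw [S.map_inl, S.map_inl, inner_smul_right, inner_smul_left]
      rcases eq_or_ne k i with rfl | h
      · simp only [HilbertBasis.inner_self_eq_one, conj_trivial]
        ring
      · rw [S.u.inner_eq_zero_of_ne (by simpa using h), S.v.inner_eq_zero_of_ne (by simpa using h)]
        ring
    · rw [S.map_inr, S.v.inner_eq_zero_of_ne (by simp), inner_zero_left, mul_zero]
  · simp [S.map_inr]

theorem fwd_inl (θ : ℕ ⊕ P → ℝ) (i : ℕ) : S.fwd θ (Sum.inl i) = S.s i * θ (Sum.inl i) := by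
  unfold fwd
  rw [opCoord_apply_of_eq_single (i := Sum.inl i), S.inner_map_inl, HilbertBasis.inner_self_eq_one,
    mul_one]
  rintro (i' | p) h
  · rw [S.inner_map_inl, S.u.inner_eq_zero_of_ne (by simpa using fun h' => h (by rw [h'])), mul_zero]
  · rw [S.map_inr, inner_zero_right]

theorem fwd_inr (θ : ℕ ⊕ P → ℝ) (q : Q) : S.fwd θ (Sum.inr q) = 0 := by
  unfold fwd
  refine opCoord_apply_eq_zero _ _ _ _ ?_
  rintro (i | p)
  · rw [S.inner_map_inl, S.u.inner_eq_zero_of_ne (by simp), mul_zero]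
  · rw [S.map_inr, inner_zero_right]

theorem bwd_apply (z : ℕ ⊕ Q → ℝ) (i : ℕ ⊕ P) : S.bwd z i = S.weight i * transfer P z i := by
  unfold bwd
  rcases i with i | p
  · rw [opCoord_apply_of_eq_single (i := Sum.inl i), ContinuousLinearMap.adjoint_inner_right,
      real_inner_comm, S.inner_map_inl, HilbertBasis.inner_self_eq_one, mul_one]
    · rfl
    · intro k hk
      rw [ContinuousLinearMap.adjoint_inner_right, real_inner_comm, S.inner_map_inl,
        S.u.inner_eq_zero_of_ne hk, mul_zero]
  · rw [opCoord_apply_eq_zero]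
    · simp
    · intro k
      rw [ContinuousLinearMap.adjoint_inner_right, S.map_inr, inner_zero_left]

/-- The gain `w / (1 + j w²)` of the update `𝒜_j`, for the singular value `w`. -/
def gain (j : ℕ) (i : ℕ ⊕ P) : ℝ := S.weight i / (1 + j * S.weight i ^ 2)

/-- The posterior variance `1 / (1 + j w²)` after `j` observations, for the singular value `w`. -/
def postVar (j : ℕ) (i : ℕ ⊕ P) : ℝ := 1 / (1 + j * S.weight i ^ 2)

/-- The factor `j⁻¹ w / (w² + j⁻¹)` simplifies to the gain, which exhibits the preconditioned
gradient step as a Kalman step in each coordinate. -/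
theorem update_apply {j : ℕ} (hj : 1 ≤ j) (θ : ℕ ⊕ P → ℝ) (z : ℕ ⊕ Q → ℝ) (i : ℕ ⊕ P) :
    S.update j (θ, z) i = θ i + S.gain j i * (transfer P z i - S.weight i * θ i) := by
  have h1 : S.score θ z i = S.weight i * (transfer P z i - S.weight i * θ i) := by
    unfold score
    rw [S.bwd_apply]
    rcases i with i | p
    · simp [fwd_inl]
    · simp
  have hp : ∀ i, precond A j (S.v i) = (S.weight i ^ 2 + (j : ℝ)⁻¹)⁻¹ • S.v i := fun i =>
    precond_apply_eq hj (sq_nonneg _) (S.adjoint_map i)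
  have h2 : opCoord S.v S.v (precond A j) (S.score θ z) i
      = (S.weight i ^ 2 + (j : ℝ)⁻¹)⁻¹ * S.score θ z i := by
    rw [opCoord_apply_of_eq_single (i := i), hp, inner_smul_right,
      HilbertBasis.inner_self_eq_one, mul_one]
    intro k hk
    rw [hp, inner_smul_right, S.v.inner_eq_zero_of_ne hk.symm, mul_zero]
  have hj' : (0 : ℝ) < j := by positivity
  simp only [update, Pi.add_apply, Pi.smul_apply, smul_eq_mul, h2, h1, gain]
  field_simp
  ring_nf

end SingularSystem

end Coordinates

/-! ### The posterior -/

theorem measurable_finSnoc {Y : Type*} [MeasurableSpace Y] (j : ℕ) :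
    Measurable fun p : (Fin j → Y) × Y => (Fin.snoc p.1 p.2 : Fin (j + 1) → Y) := by
  refine measurable_pi_lambda _ fun i => ?_
  induction i using Fin.lastCases with
  | last => simpa using measurable_snd
  | cast i => simpa using! (measurable_pi_apply i).comp measurable_fst

theorem measurable_finInit {Y : Type*} [MeasurableSpace Y] (j : ℕ) :
    Measurable fun z : Fin (j + 1) → Y => (Fin.init z : Fin j → Y) :=
  measurable_pi_lambda _ fun i => measurable_pi_apply i.castSucc

theorem lintegral_pi_succ_last {Y : Type*} [MeasurableSpace Y] (μ : Measure Y)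
    [IsProbabilityMeasure μ] (j : ℕ) {f : (Fin (j + 1) → Y) → ℝ≥0∞} (hf : Measurable f) :
    ∫⁻ z, f z ∂Measure.pi (fun _ : Fin (j + 1) => μ)
      = ∫⁻ z, ∫⁻ y, f (Fin.snoc z y) ∂μ ∂Measure.pi fun _ : Fin j => μ := by
  have h := (measurePreserving_piFinSuccAbove (fun _ : Fin (j + 1) => μ) (Fin.last j)).symm
  have hm : Measurable fun p : Y × (Fin j → Y) => f (Fin.snoc p.2 p.1) :=
    hf.comp ((measurable_finSnoc j).comp measurable_swap)
  rw [← h.lintegral_comp hf, ← lintegral_prod_symm _ hm.aemeasurable]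
  refine lintegral_congr fun p => ?_
  congr 1
  simp [MeasurableEquiv.piFinSuccAbove]
  rfl

namespace MPModel

variable {I K : Type*} (M : MPModel I K)

theorem lintegral_dataLaw (j : ℕ) {f : (Fin j → K → ℝ) → ℝ≥0∞} (hf : Measurable f) :
    ∫⁻ z, f z ∂M.dataLaw j = ∫⁻ θ, ∫⁻ z, f z ∂M.sample j θ ∂M.prior :=
  Measure.lintegral_bind (M.sample j).measurable.aemeasurable hf.aemeasurable

instance (j : ℕ) : IsProbabilityMeasure (M.dataLaw j) := by
  unfold dataLaw; infer_instance

theorem lintegral_sample_succ (j : ℕ) (θ : I → ℝ) {f : (Fin (j + 1) → K → ℝ) → ℝ≥0∞}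
    (hf : Measurable f) :
    ∫⁻ z, f z ∂M.sample (j + 1) θ = ∫⁻ z, ∫⁻ y, f (Fin.snoc z y) ∂M.lik θ ∂M.sample j θ :=
  lintegral_pi_succ_last (M.lik θ) j hf

theorem measurable_estimate (j : ℕ) : Measurable (M.estimate j) := by
  induction j with
  | zero => exact measurable_const
  | succ j ih =>
    exact (M.measurable_alg _).comp
      ((ih.comp (measurable_finInit j)).prodMk (measurable_pi_apply (Fin.last j)))

theorem estimate_snoc (j : ℕ) (z : Fin j → K → ℝ) (y : K → ℝ) :
    M.estimate (j + 1) (Fin.snoc z y : Fin (j + 1) → K → ℝ)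
      = M.alg (j + 1) (M.estimate j z, y) := by
  simp [estimate]

end MPModel

namespace SingularSystem

set_option linter.unusedSectionVars false

variable {H Z : Type*} [NormedAddCommGroup H] [InnerProductSpace ℝ H] [CompleteSpace H]
  [NormedAddCommGroup Z] [InnerProductSpace ℝ Z] [CompleteSpace Z]
  {A : H →L[ℝ] Z} {P Q : Type*} [Countable P] [Countable Q] (S : SingularSystem A P Q) (α : ℝ)

theorem lik_model (θ : ℕ ⊕ P → ℝ) :
    (S.model α).lik θ = (isoNormal (ℕ ⊕ Q)).map fun y => S.fwd θ + y := by
  have hm : Measurable fun x : (ℕ ⊕ P → ℝ) × (ℕ ⊕ Q → ℝ) => S.fwd x.1 + x.2 :=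
    (S.measurable_fwd.comp measurable_fst).add measurable_snd
  change ((Kernel.id ×ₖ Kernel.const _ (isoNormal (ℕ ⊕ Q))).map fun x => S.fwd x.1 + x.2) θ = _
  rw [Kernel.map_apply _ hm, Kernel.prod_apply, Kernel.id_apply, Kernel.const_apply,
    Measure.dirac_prod, Measure.map_map hm (by fun_prop)]
  rfl

theorem lintegral_lik (θ : ℕ ⊕ P → ℝ) {f : (ℕ ⊕ Q → ℝ) → ℝ≥0∞} (hf : Measurable f) :
    ∫⁻ z, f z ∂(S.model α).lik θ = ∫⁻ y, f (S.fwd θ + y) ∂isoNormal (ℕ ⊕ Q) := by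
  rw [lik_model, lintegral_map hf (by fun_prop)]

theorem alg_model {j : ℕ} (hj : 1 ≤ j) (θ : ℕ ⊕ P → ℝ) (z : ℕ ⊕ Q → ℝ) (i : ℕ ⊕ P) :
    (S.model α).alg j (θ, z) i = θ i + S.gain j i * (transfer P z i - S.weight i * θ i) :=
  S.update_apply hj θ z i

theorem postVar_pos (j : ℕ) (i : ℕ ⊕ P) : 0 < S.postVar j i := by
  unfold postVar; positivity

/-- Precisions add: this is `1 / V_{j+1} = 1 / V_j + w²` without denominators. -/
theorem postVar_succ (j : ℕ) (i : ℕ ⊕ P) :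
    S.postVar (j + 1) i * (1 + S.weight i ^ 2 * S.postVar j i) = S.postVar j i := by
  have h1 : 0 < 1 + (j : ℝ) * S.weight i ^ 2 := by positivity
  have h2 : 0 < 1 + ((j : ℝ) + 1) * S.weight i ^ 2 := by positivity
  simp only [postVar, Nat.cast_add, Nat.cast_one]
  field_simp
  ring

theorem gain_eq (j : ℕ) (i : ℕ ⊕ P) : S.gain j i = S.weight i * S.postVar j i := by
  simp only [gain, postVar]; ring

/-- The point with coordinates `x` relative to the posterior given `z`. -/
def postPoint (j : ℕ) (z : Fin j → ℕ ⊕ Q → ℝ) (x : ℕ ⊕ P → ℝ) : ℕ ⊕ P → ℝ :=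
  fun i => (S.model α).estimate j z i + √(S.postVar j i) * x i

theorem measurable_postPoint (j : ℕ) :
    Measurable fun p : (Fin j → ℕ ⊕ Q → ℝ) × (ℕ ⊕ P → ℝ) => S.postPoint α j p.1 p.2 := by
  have h := (S.model α).measurable_estimate j
  refine measurable_pi_lambda _ fun i => ?_
  exact ((measurable_pi_apply i).comp (h.comp measurable_fst)).add
    (((measurable_pi_apply i).comp measurable_snd).const_mul _)

/-- One observation, in terms of the posterior given the previous ones: there is a function
`predict` such that after a rotation of the noise the new data point depends only on the first
component, and the parameter is the new posterior mean plus a multiple of the second. -/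
theorem exists_predict (j : ℕ) : ∃ (c d : ℕ → ℝ)
    (predict : (Fin j → ℕ ⊕ Q → ℝ) → (ℕ ⊕ Q → ℝ) → (ℕ ⊕ Q → ℝ)),
    (∀ l, 0 ≤ d l) ∧ (∀ l, c l ^ 2 + d l ^ 2 = 1) ∧
    (Measurable fun p : (Fin j → ℕ ⊕ Q → ℝ) × (ℕ ⊕ Q → ℝ) => predict p.1 p.2) ∧
    (∀ z (p : (ℕ ⊕ Q → ℝ) × (ℕ ⊕ P → ℝ)),
      S.fwd (S.postPoint α j z p.2) + p.1 = predict z (sharedRot c d p).1 ∧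
      S.postPoint α j z p.2 = S.postPoint α (j + 1)
        (Fin.snoc z (predict z (sharedRot c d p).1) : Fin (j + 1) → ℕ ⊕ Q → ℝ)
        (sharedRot c d p).2) := by
  have hb : ∀ l : ℕ, 0 ≤ S.s l * √(S.postVar j (Sum.inl l)) := fun l =>
    mul_nonneg (S.s_pos l).le (Real.sqrt_nonneg _)
  -- The innovation is `y + s √V x`, with observation noise `y` and posterior noise `x`. Its
  -- normalised direction gives the first axis after rotation; the second axis is the independent
  -- residual.
  choose c d hd hcd hc hs using fun l => exists_sqrt_mul_eq (a := 1) (hb l)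
  refine ⟨c, d, fun z y => S.fwd ((S.model α).estimate j z) + Sum.elim
    (fun l => √(1 ^ 2 + (S.s l * √(S.postVar j (Sum.inl l))) ^ 2) * y (Sum.inl l))
    (fun q => y (Sum.inr q)), hd, hcd, ?_, fun z p => ?_⟩
  · refine (S.measurable_fwd.comp
      (((S.model α).measurable_estimate j).comp measurable_fst)).add ?_
    refine measurable_pi_lambda _ fun i => ?_
    rcases i with i | i <;> simp only [Sum.elim_inl, Sum.elim_inr] <;> fun_prop
  have h1 : S.fwd (S.postPoint α j z p.2) + p.1 = S.fwd ((S.model α).estimate j z) + Sum.elim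
      (fun l => √(1 ^ 2 + (S.s l * √(S.postVar j (Sum.inl l))) ^ 2)
        * (sharedRot c d p).1 (Sum.inl l)) (fun q => (sharedRot c d p).1 (Sum.inr q)) := by
    funext k
    rcases k with l | q
    · simp only [Pi.add_apply, fwd_inl, postPoint, Sum.elim_inl, sharedRot]
      linear_combination (-p.1 (Sum.inl l)) * hc l - p.2 (Sum.inl l) * hs l
    · simp only [Pi.add_apply, fwd_inr, Sum.elim_inr, sharedRot]
  refine ⟨h1, ?_⟩
  beta_reduce
  rw [← h1]
  funext i
  simp only [postPoint, (S.model α).estimate_snoc, alg_model S α (Nat.succ_le_succ j.zero_le)]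
  rcases i with l | q
  · simp only [transfer_inl, Pi.add_apply, fwd_inl, weight_inl, sharedRot, Sum.elim_inl, postPoint]
    have hV := S.postVar_pos j (Sum.inl l)
    have hV' := S.postVar_pos (j + 1) (Sum.inl l)
    have hr := Real.sq_sqrt hV.le
    have hr' := Real.sq_sqrt hV'.le
    have hsucc := S.postVar_succ j (Sum.inl l)
    have hg := S.gain_eq (j + 1) (Sum.inl l)
    have hcl := hc l
    have hsl := hs l
    simp only [weight_inl] at hsucc hg
    set V := S.postVar j (Sum.inl l)
    set V' := S.postVar (j + 1) (Sum.inl l)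
    set s := S.s l
    -- The square root of the variance recursion; `r` is the standard deviation of the innovation.
    have e1 : √V = √V' * √(1 ^ 2 + (s * √V) ^ 2) := by
      rw [← Real.sqrt_mul hV'.le]
      congr 1
      rw [mul_pow, hr]
      linarith
    set r := √(1 ^ 2 + (s * √V) ^ 2)
    have hr2 : r ^ 2 = 1 + s ^ 2 * V := by
      rw [Real.sq_sqrt (by positivity), mul_pow, hr]; ring
    have e5 : V' * r = √V' * √V := by linear_combination (-r) * hr' - √V' * e1
    -- The new residual is `√V (1 - g s) x - g y` and should equal `√V' (c x - d y)`; `e4` and `e6`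
    -- match the two coefficients.
    have e4 : S.gain (j + 1) (Sum.inl l) = √V' * d l := by
      have hrp : 0 < r := Real.sqrt_pos.2 (by positivity)
      refine mul_right_cancel₀ hrp.ne' ?_
      rw [hg, mul_assoc (√V'), mul_comm (d l), hsl, mul_assoc, e5]
      ring
    have e6 : √V * (1 - S.gain (j + 1) (Sum.inl l) * s) = √V' * c l := by
      have hrp : 0 < r := Real.sqrt_pos.2 (by positivity)
      refine mul_right_cancel₀ (pow_ne_zero 2 hrp.ne') ?_
      have : (1 - s * V' * s) * r ^ 2 = 1 := by
        rw [hr2]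
        linear_combination (-s ^ 2) * hsucc
      rw [hg, mul_assoc, this]
      linear_combination e1 - √V' * r * hcl
    linear_combination (-p.1 (Sum.inl l)) * e4 + p.2 (Sum.inl l) * e6
  -- In kernel directions nothing is learned: the gain is zero and the variance stays one.
  · have hg : S.gain (j + 1) (Sum.inr q) = 0 := by simp [gain]
    simp [hg, sharedRot, postVar]

/-- The joint law of parameter and data, disintegrated with respect to the data. -/
theorem lintegral_prior_sample (j : ℕ) {f : (ℕ ⊕ P → ℝ) → (Fin j → ℕ ⊕ Q → ℝ) → ℝ≥0∞}
    (hf : Measurable (Function.uncurry f)) :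
    ∫⁻ θ, ∫⁻ z, f θ z ∂(S.model α).sample j θ ∂(S.model α).prior
      = ∫⁻ z, ∫⁻ x, f (S.postPoint α j z x) z ∂isoNormal (ℕ ⊕ P) ∂(S.model α).dataLaw j := by
  induction j with
  | zero =>
    have h2 : ∀ z x, S.postPoint α 0 z x = x := fun z x => by
      funext i
      simp only [postPoint, MPModel.estimate, postVar]
      simp [model]
    have h3 : ∀ θ z, f θ z = f θ default := fun θ z => by rw [Subsingleton.elim z default]
    simp only [h2, h3, lintegral_const, measure_univ, mul_one]
    rfl
  | succ j ih =>
    obtain ⟨c, d, predict, hd, hcd, hpm, hp⟩ := S.exists_predict α j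
    -- This is kept general in `f` because it is used twice: for the given integrand, and for the
    -- inner integral as a function of the data alone. The second use identifies the law of the
    -- extended sample with the data law at `j + 1`.
    have key : ∀ {f : (ℕ ⊕ P → ℝ) → (Fin (j + 1) → ℕ ⊕ Q → ℝ) → ℝ≥0∞},
        Measurable (Function.uncurry f) →
        ∫⁻ θ, ∫⁻ z, f θ z ∂(S.model α).sample (j + 1) θ ∂(S.model α).prior
          = ∫⁻ z, ∫⁻ y, ∫⁻ x, f (S.postPoint α (j + 1) (Fin.snoc z (predict z y)) x)
              (Fin.snoc z (predict z y)) ∂isoNormal (ℕ ⊕ P) ∂isoNormal (ℕ ⊕ Q)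
              ∂(S.model α).dataLaw j := by
      intro f hf
      have m1 : Measurable fun q : ((ℕ ⊕ P → ℝ) × (Fin j → ℕ ⊕ Q → ℝ)) × (ℕ ⊕ Q → ℝ) =>
          f q.1.1 (Fin.snoc q.1.2 (S.fwd q.1.1 + q.2)) :=
        hf.comp ((measurable_fst.comp measurable_fst).prodMk ((measurable_finSnoc j).comp
          ((measurable_snd.comp measurable_fst).prodMk
            ((S.measurable_fwd.comp (measurable_fst.comp measurable_fst)).add measurable_snd))))
      have e1 : ∀ θ, ∫⁻ z, f θ z ∂(S.model α).sample (j + 1) θ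
          = ∫⁻ z, ∫⁻ y, f θ (Fin.snoc z (S.fwd θ + y)) ∂isoNormal (ℕ ⊕ Q)
            ∂(S.model α).sample j θ := fun θ => by
        have hθ : Measurable (f θ) := hf.comp measurable_prodMk_left
        rw [MPModel.lintegral_sample_succ _ _ _ hθ]
        exact lintegral_congr fun z => S.lintegral_lik α θ
          (hθ.comp ((measurable_finSnoc j).comp measurable_prodMk_left))
      simp only [e1]
      rw [ih (f := fun θ z => ∫⁻ y, f θ (Fin.snoc z (S.fwd θ + y)) ∂isoNormal (ℕ ⊕ Q))
        m1.lintegral_prod_right']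
      refine lintegral_congr fun z => ?_
      have hpp : Measurable (S.postPoint α j z) :=
        (S.measurable_postPoint α j).comp measurable_prodMk_left
      have m2 : Measurable fun p : (ℕ ⊕ Q → ℝ) × (ℕ ⊕ P → ℝ) =>
          f (S.postPoint α j z p.2) (Fin.snoc z (S.fwd (S.postPoint α j z p.2) + p.1)) :=
        m1.comp (((hpp.comp measurable_snd).prodMk measurable_const).prodMk measurable_fst)
      have ms : Measurable fun y => (Fin.snoc z (predict z y) : Fin (j + 1) → ℕ ⊕ Q → ℝ) :=
        (measurable_finSnoc j).comp (measurable_const.prodMk (hpm.comp measurable_prodMk_left))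
      have m3 : Measurable fun p : (ℕ ⊕ Q → ℝ) × (ℕ ⊕ P → ℝ) =>
          f (S.postPoint α (j + 1) (Fin.snoc z (predict z p.1)) p.2)
            (Fin.snoc z (predict z p.1)) :=
        hf.comp (((S.measurable_postPoint α (j + 1)).comp
          ((ms.comp measurable_fst).prodMk measurable_snd)).prodMk (ms.comp measurable_fst))
      -- The product law is replaced by its rotated image; the change of variables acts on the right
      -- integral only, and the last rewrite restores the left one.
      rw [← lintegral_prod_symm _ m2.aemeasurable, ← lintegral_prod _ m3.aemeasurable,
        ← map_sharedRot_isoNormal hd hcd, lintegral_map m3 (measurable_sharedRot c d),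
        map_sharedRot_isoNormal hd hcd]
      refine lintegral_congr fun p => ?_
      obtain ⟨h1, h2⟩ := hp z p
      rw [← h2, h1]
    rw [key hf]
    have mh : Measurable fun z =>
        ∫⁻ x, f (S.postPoint α (j + 1) z x) z ∂isoNormal (ℕ ⊕ P) :=
      Measurable.lintegral_prod_right' (f := fun p : (Fin (j + 1) → ℕ ⊕ Q → ℝ) × (ℕ ⊕ P → ℝ) =>
        f (S.postPoint α (j + 1) p.1 p.2) p.1)
        (hf.comp ((S.measurable_postPoint α (j + 1)).prodMk measurable_fst))
    rw [MPModel.lintegral_dataLaw _ _ mh, key (f := fun _ z => ∫⁻ x, f (S.postPoint α (j + 1) z x) z ∂isoNormal (ℕ ⊕ P))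
      (mh.comp measurable_snd)]
    simp

/-- The explicit posterior. -/
def gaussPost (j : ℕ) : Kernel (Fin j → ℕ ⊕ Q → ℝ) (ℕ ⊕ P → ℝ) :=
  (Kernel.id ×ₖ Kernel.const _ (isoNormal (ℕ ⊕ P))).map fun p => S.postPoint α j p.1 p.2

instance (j : ℕ) : IsMarkovKernel (S.gaussPost α j) :=
  Kernel.IsMarkovKernel.map _ (S.measurable_postPoint α j)

theorem gaussPost_apply (j : ℕ) (z : Fin j → ℕ ⊕ Q → ℝ) :
    S.gaussPost α j z = (isoNormal (ℕ ⊕ P)).map (S.postPoint α j z) := by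
  have hm := S.measurable_postPoint α j
  rw [gaussPost, Kernel.map_apply _ hm, Kernel.prod_apply, Kernel.id_apply, Kernel.const_apply,
    Measure.dirac_prod, Measure.map_map hm (by fun_prop)]
  rfl

theorem measurable_postPoint_right (j : ℕ) (z : Fin j → ℕ ⊕ Q → ℝ) :
    Measurable (S.postPoint α j z) :=
  (S.measurable_postPoint α j).comp measurable_prodMk_left

/-- A posterior kernel is determined almost everywhere by the joint law, which `gaussPost`
disintegrates by `lintegral_prior_sample`. -/
theorem post_ae_eq (j : ℕ) :
    ∀ᵐ z ∂(S.model α).dataLaw j,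
      (S.model α).post j z = (isoNormal (ℕ ⊕ P)).map (S.postPoint α j z) := by
  have h : (S.model α).dataLaw j ⊗ₘ S.gaussPost α j
      = ((S.model α).prior ⊗ₘ (S.model α).sample j).map Prod.swap := by
    refine Measure.ext_of_lintegral _ fun f hf => ?_
    rw [lintegral_map hf measurable_swap, Measure.lintegral_compProd hf,
      Measure.lintegral_compProd (f := fun p => f p.swap) (hf.comp measurable_swap)]
    have := S.lintegral_prior_sample α j (f := fun θ z => f (z, θ)) (hf.comp measurable_swap)
    simp only [Prod.swap_prod_mk]
    rw [this]
    refine lintegral_congr fun z => ?_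
    rw [gaussPost_apply, lintegral_map (f := fun θ => f (z, θ)) (hf.comp measurable_prodMk_left)
      (S.measurable_postPoint_right α j z)]
  filter_upwards [ae_eq_posterior_of_compProd_eq h] with z hz
  rw [← gaussPost_apply, hz]
  rfl

theorem integral_isoNormal_apply {I : Type*} (i : I) : ∫ x, x i ∂isoNormal I = 0 := by
  have h := Measure.infinitePi_map_eval (fun _ : I => gaussianReal 0 1) i
  rw [← integral_map (φ := fun x : I → ℝ => x i) (f := fun t => t) (measurable_pi_apply i).aemeasurable
    measurable_id.aestronglyMeasurable]
  unfold isoNormal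
  rw [h]
  simp

theorem integrable_isoNormal_apply {I : Type*} (i : I) :
    Integrable (fun x : I → ℝ => x i) (isoNormal I) := by
  have h := Measure.infinitePi_map_eval (fun _ : I => gaussianReal 0 1) i
  have : Integrable (fun t : ℝ => t) ((isoNormal I).map fun x => x i) := by
    unfold isoNormal
    rw [h]
    exact (memLp_id_gaussianReal 1).integrable le_rfl
  exact this.comp_measurable (by fun_prop)

theorem postMean_ae_eq (j : ℕ) :
    ∀ᵐ z ∂(S.model α).dataLaw j, (S.model α).estimate j z = (S.model α).postMean j z := by
  filter_upwards [S.post_ae_eq α j] with z hz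
  funext i
  rw [MPModel.postMean, hz, integral_map (S.measurable_postPoint_right α j z).aemeasurable
    (measurable_pi_apply i).aestronglyMeasurable]
  simp only [postPoint]
  rw [integral_add (integrable_const _) ((integrable_isoNormal_apply i).const_mul _),
    integral_const_mul, integral_isoNormal_apply]
  simp

end SingularSystem

/-! ### Weighted norms, the posterior radius and the risk -/

theorem diagNorm_sq {P : Type*} (s : ℕ → ℝ) (a : ℝ) (x : ℕ ⊕ P → ℝ) :
    diagNorm s a x ^ 2
      = ∑' i, ENNReal.ofReal (Sum.elim s (fun _ => 0) i) ^ (2 * a) * ENNReal.ofReal (x i ^ 2) := by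
  unfold diagNorm
  rw [← ENNReal.rpow_natCast, ← ENNReal.rpow_mul]
  norm_num

theorem lintegral_isoNormal_sq {I : Type*} (i : I) :
    ∫⁻ x, ENNReal.ofReal (x i ^ 2) ∂isoNormal I = 1 := by
  have h := Measure.infinitePi_map_eval (fun _ : I => gaussianReal 0 1) i
  rw [← lintegral_map (f := fun t : ℝ => ENNReal.ofReal (t ^ 2)) (g := fun x : I → ℝ => x i)
    (by fun_prop) (by fun_prop)]
  unfold isoNormal
  have hint : Integrable (fun t : ℝ => t ^ 2) (gaussianReal 0 1) :=
    (memLp_id_gaussianReal 2).integrable_sq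
  have hv := variance_eq_integral (μ := gaussianReal 0 1) (X := fun t : ℝ => t) aemeasurable_id
  rw [variance_fun_id_gaussianReal, integral_id_gaussianReal] at hv
  simp only [sub_zero, NNReal.coe_one] at hv
  rw [h, ← ofReal_integral_eq_lintegral_ofReal hint (ae_of_all _ fun _ => sq_nonneg _), ← hv,
    ENNReal.ofReal_one]

/-- Tonelli in `ℝ≥0∞`, so infinite weights and divergent sums are covered. -/
theorem lintegral_isoNormal_tsum_mul_sq {I : Type*} [Countable I] (D : I → ℝ≥0∞) (a : I → ℝ) :
    ∫⁻ x, ∑' i, D i * ENNReal.ofReal ((a i * x i) ^ 2) ∂isoNormal I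
      = ∑' i, D i * ENNReal.ofReal (a i ^ 2) := by
  rw [lintegral_tsum fun i => Measurable.aemeasurable (by fun_prop)]
  refine tsum_congr fun i => ?_
  rw [lintegral_const_mul _ (by fun_prop)]
  congr 1
  simp only [mul_pow, ENNReal.ofReal_mul (sq_nonneg (a i))]
  rw [lintegral_const_mul _ (by fun_prop), lintegral_isoNormal_sq, mul_one]

namespace SingularSystem

set_option linter.unusedSectionVars false

variable {H Z : Type*} [NormedAddCommGroup H] [InnerProductSpace ℝ H] [CompleteSpace H]
  [NormedAddCommGroup Z] [InnerProductSpace ℝ Z] [CompleteSpace Z]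
  {A : H →L[ℝ] Z} {P Q : Type*} [Countable P] [Countable Q] (S : SingularSystem A P Q) (α : ℝ)

/-- The weights of the squared norm on parameters. -/
def normWeight (i : ℕ ⊕ P) : ℝ≥0∞ := ENNReal.ofReal (S.weight i) ^ (2 * α)

theorem nrm_sq (x : ℕ ⊕ P → ℝ) :
    (S.model α).nrm x ^ 2 = ∑' i, S.normWeight α i * ENNReal.ofReal (x i ^ 2) :=
  diagNorm_sq S.s α x

theorem nrmZ_sq (z : ℕ ⊕ Q → ℝ) :
    (S.model α).nrmZ z ^ 2 = ∑' k, ENNReal.ofReal (Sum.elim S.s (fun _ => 0) k) ^ (2 * (α - 1))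
      * ENNReal.ofReal (z k ^ 2) :=
  diagNorm_sq S.s (α - 1) z

theorem nrm_sub_comm (x y : ℕ ⊕ P → ℝ) :
    (S.model α).nrm (x - y) ^ 2 = (S.model α).nrm (y - x) ^ 2 := by
  simp only [nrm_sq, Pi.sub_apply]
  exact tsum_congr fun i => by rw [← neg_sub, neg_sq]

theorem measurable_nrm_sq : Measurable fun x => (S.model α).nrm x ^ 2 := by
  simp only [nrm_sq]
  exact Measurable.tsum fun i => by fun_prop

theorem lintegral_nrm_sq_mul (a : ℕ ⊕ P → ℝ) :
    ∫⁻ x, (S.model α).nrm (fun i => a i * x i) ^ 2 ∂isoNormal (ℕ ⊕ P)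
      = ∑' i, S.normWeight α i * ENNReal.ofReal (a i ^ 2) := by
  simp only [nrm_sq]
  exact lintegral_isoNormal_tsum_mul_sq _ _

theorem lintegral_nrm_postPoint_sub (j : ℕ) (z : Fin j → ℕ ⊕ Q → ℝ) :
    ∫⁻ x, (S.model α).nrm (S.postPoint α j z x - (S.model α).estimate j z) ^ 2
      ∂isoNormal (ℕ ⊕ P) = ∑' i, S.normWeight α i * ENNReal.ofReal (S.postVar j i) := by
  have h := S.lintegral_nrm_sq_mul α fun i => √(S.postVar j i)
  simp only [Real.sq_sqrt (S.postVar_pos j _).le] at h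
  rw [← h]
  refine lintegral_congr fun x => ?_
  congr 2
  funext i
  simp [postPoint]

theorem ae_ae_of_ae_dataLaw {j : ℕ} {p : (Fin j → ℕ ⊕ Q → ℝ) → Prop}
    (h : ∀ᵐ z ∂(S.model α).dataLaw j, p z) :
    ∀ᵐ θ ∂(S.model α).prior, ∀ᵐ z ∂(S.model α).sample j θ, p z :=
  Measure.ae_ae_of_ae_comp h

theorem lintegral_prior_const (c : ℝ≥0∞) (j : ℕ) :
    ∫⁻ θ, ∫⁻ _, c ∂(S.model α).sample j θ ∂(S.model α).prior = c := by simp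

/-- The posterior spread does not depend on the data, so the outer averages are over a constant,
possibly infinite. -/
theorem radiusSq_eq (j : ℕ) : (S.model α).radiusSq j
    = ∑' i, S.normWeight α i * ENNReal.ofReal (S.postVar j i) := by
  unfold MPModel.radiusSq
  rw [← S.lintegral_prior_const α (∑' i, S.normWeight α i * ENNReal.ofReal (S.postVar j i)) j]
  refine lintegral_congr_ae ?_
  filter_upwards [S.ae_ae_of_ae_dataLaw α ((S.post_ae_eq α j).and (S.postMean_ae_eq α j))] with θ hθ
  refine lintegral_congr_ae ?_
  filter_upwards [hθ] with z hz
  rw [hz.1, ← hz.2, lintegral_map (f := fun θ => (S.model α).nrm (θ - (S.model α).estimate j z) ^ 2)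
    ((S.measurable_nrm_sq α).comp (measurable_id.sub_const _))
    (S.measurable_postPoint_right α j z)]
  exact S.lintegral_nrm_postPoint_sub α j z

theorem risk_eq (j : ℕ) : (S.model α).risk j = (S.model α).radiusSq j := by
  have hm : Measurable fun p : (ℕ ⊕ P → ℝ) × (Fin j → ℕ ⊕ Q → ℝ) =>
      (S.model α).nrm ((S.model α).estimate j p.2 - p.1) ^ 2 :=
    (S.measurable_nrm_sq α).comp
      ((((S.model α).measurable_estimate j).comp measurable_snd).sub measurable_fst)
  rw [radiusSq_eq, MPModel.risk, S.lintegral_prior_sample α j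
    (f := fun θ z => (S.model α).nrm ((S.model α).estimate j z - θ) ^ 2) hm]
  simp only [S.nrm_sub_comm α ((S.model α).estimate j _), lintegral_nrm_postPoint_sub]
  simp

theorem excessSq_eq_zero (j : ℕ) : (S.model α).excessSq j = 0 := by
  -- Truncated subtraction gives `∞ - ∞ = 0`, so finiteness of the radius is not needed.
  rw [MPModel.excessSq, risk_eq, tsub_self]

end SingularSystem

/-! ### The imputation path -/

section Path

namespace MPModel

variable {I K : Type*} (M : MPModel I K)

/-- The transition kernels of the imputation path started at time `n`. -/
def pathKernel (n k : ℕ) : Kernel ((i : Finset.Iic k) → I → ℝ) (I → ℝ) :=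
  (M.stepKernel (n + k + 1)).comap
    (fun h : (i : Finset.Iic k) → I → ℝ => h ⟨k, Finset.mem_Iic.2 le_rfl⟩) (measurable_pi_apply _)

instance (n k : ℕ) : IsMarkovKernel (M.pathKernel n k) := by
  unfold pathKernel; infer_instance

theorem mpPath_eq_traj (n : ℕ) (θ : I → ℝ) :
    M.mpPath n θ = Kernel.traj (X := fun _ => I → ℝ) (M.pathKernel n) 0 (fun _ => θ) := rfl

instance (n : ℕ) (θ : I → ℝ) : IsProbabilityMeasure (M.mpPath n θ) := by
  rw [mpPath_eq_traj]; infer_instance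

/-- The Markov property: the path kernel reads only the last entry of the history. -/
theorem mpPath_map_succ (n k : ℕ) (θ : I → ℝ) :
    (M.mpPath n θ).map (fun x => x (k + 1))
      = ((M.mpPath n θ).map fun x => x k).bind (M.stepKernel (n + k + 1)) := by
  have h := Kernel.partialTraj_compProd_eq_map_traj (X := fun _ => I → ℝ)
    (κ := M.pathKernel n) (Nat.zero_le k) (x₀ := fun _ => θ)
  have h2 := congrArg (fun μ => μ.map Prod.snd) h
  rw [Measure.map_map measurable_snd (by fun_prop), ← mpPath_eq_traj] at h2
  refine h2.symm.trans ?_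
  refine Measure.ext_of_lintegral _ fun f hf => ?_
  rw [lintegral_map hf measurable_snd,
    Measure.lintegral_compProd (f := fun p => f p.2) (hf.comp measurable_snd),
    Measure.lintegral_bind (Kernel.measurable _).aemeasurable hf.aemeasurable,
    lintegral_map (hf.lintegral_kernel) (measurable_pi_apply k), mpPath_eq_traj,
    ← Kernel.traj_map_frestrictLe, Kernel.map_apply _ (Preorder.measurable_frestrictLe k),
    lintegral_map (Measurable.lintegral_kernel hf) (Preorder.measurable_frestrictLe k)]
  rfl

theorem mpPath_map_zero (n : ℕ) (θ : I → ℝ) :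
    (M.mpPath n θ).map (fun x => x 0) = Measure.dirac θ := by
  have hm : Measurable fun x : (i : Finset.Iic 0) → I → ℝ => x ⟨0, Finset.mem_Iic.2 le_rfl⟩ :=
    measurable_pi_apply _
  have h := Kernel.traj_map_frestrictLe_apply (X := fun _ => I → ℝ) (κ := M.pathKernel n) 0 0
    (fun _ => θ)
  rw [Kernel.partialTraj_self, Kernel.id_apply] at h
  have h2 := congrArg (fun μ => μ.map fun x => x ⟨0, Finset.mem_Iic.2 le_rfl⟩) h
  rw [Measure.map_map hm (by fun_prop)] at h2
  exact h2.trans (Measure.map_dirac' hm _)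

end MPModel

namespace SingularSystem

set_option linter.unusedSectionVars false

variable {H Z : Type*} [NormedAddCommGroup H] [InnerProductSpace ℝ H] [CompleteSpace H]
  [NormedAddCommGroup Z] [InnerProductSpace ℝ Z] [CompleteSpace Z]
  {A : H →L[ℝ] Z} {P Q : Type*} [Countable P] [Countable Q] (S : SingularSystem A P Q) (α : ℝ)

theorem gain_nonneg (j : ℕ) (i : ℕ ⊕ P) : 0 ≤ S.gain j i := by
  have := S.weight_nonneg i
  unfold gain; positivity

@[simp] theorem gain_inr (j : ℕ) (p : P) : S.gain j (Sum.inr p) = 0 := by simp [gain]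

theorem measurable_stepPoint (j : ℕ) :
    Measurable fun p : (ℕ ⊕ P → ℝ) × (ℕ ⊕ P → ℝ) => fun i => p.1 i + S.gain j i * p.2 i := by
  fun_prop

/-- For imputed data `z - A θ` is pure noise, so the step adds noise with a scale independent of
`θ`. Noise on the data side may be exchanged for noise on the parameter side because the gain
vanishes in kernel directions. -/
theorem stepKernel_apply {j : ℕ} (hj : 1 ≤ j) (θ : ℕ ⊕ P → ℝ) :
    (S.model α).stepKernel j θ
      = (isoNormal (ℕ ⊕ P)).map fun x i => θ i + S.gain j i * x i := by
  have hm := (S.model α).measurable_alg j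
  have hf : Measurable fun y : ℕ ⊕ Q → ℝ => S.fwd θ + y := by fun_prop
  have hg := map_mul_transfer_isoNormal (Q := Q) (S.gain j) (S.gain_inr j)
  have ht : Measurable fun (y : ℕ ⊕ Q → ℝ) i => S.gain j i * transfer P y i :=
    measurable_pi_lambda _ fun i =>
      ((measurable_pi_apply i).comp measurable_transfer).const_mul _
  have e1 : (isoNormal (ℕ ⊕ P)).map (fun x i => θ i + S.gain j i * x i)
      = ((isoNormal (ℕ ⊕ P)).map fun x i => S.gain j i * x i).map fun x i => θ i + x i := by
    rw [Measure.map_map (by fun_prop) (by fun_prop)]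
    rfl
  rw [MPModel.stepKernel, Kernel.map_apply _ hm, Kernel.prod_apply, Kernel.id_apply,
    Measure.dirac_prod, Measure.map_map hm (by fun_prop), lik_model,
    Measure.map_map (hm.comp (by fun_prop)) hf, e1, ← hg, Measure.map_map (by fun_prop) ht]
  congr 1
  funext y i
  simp only [Function.comp, S.alg_model α hj]
  rcases i with i | p <;> simp [fwd_inl]

/-- The variance of the imputed parameter `k` steps after `n`. -/
def pathVar (n k : ℕ) (i : ℕ ⊕ P) : ℝ := ∑ l ∈ Finset.range k, S.gain (n + l + 1) i ^ 2

theorem pathVar_nonneg (n k : ℕ) (i : ℕ ⊕ P) : 0 ≤ S.pathVar n k i :=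
  Finset.sum_nonneg fun _ _ => sq_nonneg _

/-- The increments are independent centred Gaussians, whose variances add. -/
theorem mpPath_map_eval (n k : ℕ) (θ : ℕ ⊕ P → ℝ) :
    ((S.model α).mpPath n θ).map (fun x => x k)
      = (isoNormal (ℕ ⊕ P)).map fun x i => θ i + √(S.pathVar n k i) * x i := by
  induction k with
  | zero =>
    rw [MPModel.mpPath_map_zero]
    simp [pathVar]
  | succ k ih =>
    rw [MPModel.mpPath_map_succ, ih]
    refine Measure.ext_of_lintegral _ fun f hf => ?_
    have hs := S.measurable_stepPoint (n + k + 1)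
    have e1 := map_mul_add_mul_isoNormal (fun i => √(S.pathVar n k i)) (S.gain (n + k + 1))
      (S.gain_nonneg _)
    have e2 : ∀ i, √(S.pathVar n k i) ^ 2 + S.gain (n + k + 1) i ^ 2 = S.pathVar n (k + 1) i := by
      intro i
      rw [Real.sq_sqrt (S.pathVar_nonneg n k i), pathVar, pathVar, Finset.sum_range_succ]
    simp only [e2] at e1
    have m1 : Measurable fun y : ℕ ⊕ P → ℝ => f fun i => θ i + y i := hf.comp (by fun_prop)
    rw [Measure.lintegral_bind (Kernel.measurable _).aemeasurable hf.aemeasurable,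
      lintegral_map hf.lintegral_kernel (by fun_prop)]
    have e3 := lintegral_map (μ := isoNormal (ℕ ⊕ P)) m1
      (g := fun x i => √(S.pathVar n (k + 1) i) * x i) (by fun_prop)
    rw [lintegral_map hf (by fun_prop), ← e3, ← e1, lintegral_map m1 (by fun_prop),
      lintegral_prod (fun p : (ℕ ⊕ P → ℝ) × (ℕ ⊕ P → ℝ) => f fun i =>
        θ i + (√(S.pathVar n k i) * p.1 i + S.gain (n + k + 1) i * p.2 i))
        (Measurable.aemeasurable (hf.comp (by fun_prop)))]
    refine lintegral_congr fun x => ?_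
    rw [S.stepKernel_apply α (by omega), lintegral_map hf (by fun_prop)]
    simp only [add_assoc]

end SingularSystem

end Path

/-! ### The distance between the posterior and the martingale posterior -/

section Distance

namespace SingularSystem

set_option linter.unusedSectionVars false

variable {H Z : Type*} [NormedAddCommGroup H] [InnerProductSpace ℝ H] [CompleteSpace H]
  [NormedAddCommGroup Z] [InnerProductSpace ℝ Z] [CompleteSpace Z]
  {A : H →L[ℝ] Z} {P Q : Type*} [Countable P] [Countable Q] (S : SingularSystem A P Q) (α : ℝ)

/-- Both measures are driven by the same Gaussian sequence; any coupling bounds the infimum from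
above. -/
theorem wassersteinSq_map_isoNormal_le (m a b : ℕ ⊕ P → ℝ) :
    wassersteinSq (S.model α).nrm ((isoNormal (ℕ ⊕ P)).map fun x i => m i + a i * x i)
        ((isoNormal (ℕ ⊕ P)).map fun x i => m i + b i * x i)
      ≤ ∑' i, S.normWeight α i * ENNReal.ofReal ((a i - b i) ^ 2) := by
  have hp : Measurable fun x : ℕ ⊕ P → ℝ => (fun i => m i + a i * x i, fun i => m i + b i * x i) := by
    fun_prop
  have hγ : (isoNormal (ℕ ⊕ P)).map
      (fun x => (fun i => m i + a i * x i, fun i => m i + b i * x i)) ∈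
      {γ : Measure ((ℕ ⊕ P → ℝ) × (ℕ ⊕ P → ℝ)) |
        γ.map Prod.fst = (isoNormal (ℕ ⊕ P)).map (fun x i => m i + a i * x i) ∧
        γ.map Prod.snd = (isoNormal (ℕ ⊕ P)).map fun x i => m i + b i * x i} :=
    ⟨Measure.map_map measurable_fst hp, Measure.map_map measurable_snd hp⟩
  refine (iInf₂_le _ hγ).trans ?_
  rw [lintegral_map (f := fun p => (S.model α).nrm (p.1 - p.2) ^ 2)
    ((S.measurable_nrm_sq α).comp (measurable_fst.sub measurable_snd)) hp,
    ← S.lintegral_nrm_sq_mul α fun i => a i - b i]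
  refine le_of_eq (lintegral_congr fun x => ?_)
  congr 2
  funext i
  simp only [Pi.sub_apply]
  ring

/-- The mean distance between the posterior and a measure which given the data is a Gaussian
measure around the estimate. -/
theorem meanDistSq_le (n : ℕ) (b : ℕ ⊕ P → ℝ) (R : (Fin n → ℕ ⊕ Q → ℝ) → Measure (ℕ ⊕ P → ℝ))
    (hR : ∀ z, R z = (isoNormal (ℕ ⊕ P)).map
      fun x i => (S.model α).estimate n z i + b i * x i) :
    (S.model α).meanDistSq n R
      ≤ ∑' i, S.normWeight α i * ENNReal.ofReal ((√(S.postVar n i) - b i) ^ 2) := by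
  rw [← S.lintegral_prior_const α (∑' i, _) n]
  refine lintegral_mono_ae ?_
  filter_upwards [S.ae_ae_of_ae_dataLaw α (S.post_ae_eq α n)] with θ hθ
  refine lintegral_mono_ae ?_
  filter_upwards [hθ] with z hz
  rw [hz, hR]
  exact S.wassersteinSq_map_isoNormal_le α _ _ _

/-- The defect is `w² V_{m+1} (V_m - V_{m+1})`, and `w² V_{m+1}` is at most `1 / (m + 1)`. The
weaker factor `1 / n` is uniform in `m`, so the bounds telescope. -/
theorem postVar_sub_succ {n m : ℕ} (hnm : n ≤ m) (hn : 1 ≤ n) (i : ℕ ⊕ P) :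
    0 ≤ S.postVar m i - S.postVar (m + 1) i - S.gain (m + 1) i ^ 2 ∧
    S.postVar m i - S.postVar (m + 1) i - S.gain (m + 1) i ^ 2
      ≤ (n : ℝ)⁻¹ * (S.postVar m i - S.postVar (m + 1) i) := by
  have hw := sq_nonneg (S.weight i)
  have hn' : (0 : ℝ) < n := by exact_mod_cast hn
  have hm : (n : ℝ) ≤ m := by exact_mod_cast hnm
  have ha : 0 < 1 + (m : ℝ) * S.weight i ^ 2 := by positivity
  have hb : 0 < 1 + ((m : ℝ) + 1) * S.weight i ^ 2 := by positivity
  simp only [postVar, gain, Nat.cast_add, Nat.cast_one, div_pow]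
  set u := S.weight i ^ 2
  have e1 : 1 / (1 + (m : ℝ) * u) - 1 / (1 + ((m : ℝ) + 1) * u)
      = u / ((1 + m * u) * (1 + (m + 1) * u)) := by
    field_simp; ring
  have e2 : u / ((1 + m * u) * (1 + (m + 1) * u)) - u / (1 + ((m : ℝ) + 1) * u) ^ 2
      = u / (1 + ((m : ℝ) + 1) * u) * (u / ((1 + m * u) * (1 + (m + 1) * u))) := by
    field_simp; ring
  rw [e1, e2]
  refine ⟨by positivity, mul_le_mul_of_nonneg_right ?_ (by positivity)⟩
  rw [div_le_iff₀ hb, inv_mul_eq_div, le_div_iff₀ hn']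
  nlinarith

theorem pathVar_bounds {n : ℕ} (hn : 1 ≤ n) (k : ℕ) (i : ℕ ⊕ P) :
    0 ≤ S.postVar n i - S.postVar (n + k) i - S.pathVar n k i ∧
    S.postVar n i - S.postVar (n + k) i - S.pathVar n k i
      ≤ (n : ℝ)⁻¹ * (S.postVar n i - S.postVar (n + k) i) := by
  induction k with
  | zero => simp [pathVar]
  | succ k ih =>
    have h := S.postVar_sub_succ (Nat.le_add_right n k) hn i
    have e : S.pathVar n (k + 1) i = S.pathVar n k i + S.gain (n + k + 1) i ^ 2 :=
      Finset.sum_range_succ _ _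
    rw [e, ← add_assoc]
    constructor <;> linarith [ih.1, ih.2, h.1, h.2]

theorem pathVar_le {n : ℕ} (hn : 1 ≤ n) (k : ℕ) (i : ℕ ⊕ P) : S.pathVar n k i ≤ S.postVar n i := by
  linarith [(S.pathVar_bounds hn k i).1, S.postVar_pos (n + k) i]

theorem postVar_sub_pathVar_le {n : ℕ} (hn : 1 ≤ n) (k : ℕ) (i : ℕ ⊕ P) :
    S.postVar n i - S.pathVar n k i ≤ S.postVar n i / n + S.postVar (n + k) i := by
  have h := (S.pathVar_bounds hn k i).2
  have h2 := S.postVar_pos (n + k) i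
  have h3 : 0 ≤ (n : ℝ)⁻¹ * S.postVar (n + k) i := by positivity
  rw [div_eq_inv_mul]
  linarith

/-- The difference of the two sides is `2 √b (√a - √b)`. -/
theorem sqrt_sub_sqrt_sq_le {a b : ℝ} (hb : 0 ≤ b) (hab : b ≤ a) : (√a - √b) ^ 2 ≤ a - b := by
  have h1 := Real.sqrt_le_sqrt hab
  have h2 := Real.sq_sqrt hb
  have h3 := Real.sq_sqrt (hb.trans hab)
  nlinarith [Real.sqrt_nonneg b]

theorem tsum_normWeight_div {n : ℕ} (hn : 1 ≤ n) :
    ∑' i, S.normWeight α i * ENNReal.ofReal (S.postVar n i / n) = (S.model α).radiusSq n / n := by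
  have hn' : (0 : ℝ) < n := by exact_mod_cast hn
  simp only [radiusSq_eq, div_eq_mul_inv]
  rw [← ENNReal.tsum_mul_right]
  refine tsum_congr fun i => ?_
  rw [ENNReal.ofReal_mul (S.postVar_pos n i).le, ENNReal.ofReal_inv_of_pos hn',
    ENNReal.ofReal_natCast, mul_assoc]

theorem meanDistSq_mpLaw_le {n N : ℕ} (hn : 1 ≤ n) (hnN : n ≤ N) :
    (S.model α).meanDistSq n ((S.model α).mpLaw n N)
      ≤ (S.model α).radiusSq n / n + (S.model α).radiusSq N := by
  refine (S.meanDistSq_le α n (fun i => √(S.pathVar n (N - n) i)) _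
    fun z => S.mpPath_map_eval α n (N - n) _).trans ?_
  rw [← S.tsum_normWeight_div α hn, S.radiusSq_eq α N, ← ENNReal.tsum_add]
  refine ENNReal.tsum_le_tsum fun i => ?_
  rw [← mul_add, ← ENNReal.ofReal_add (div_nonneg (S.postVar_pos n i).le (by positivity))
    (S.postVar_pos N i).le]
  gcongr
  have h := S.postVar_sub_pathVar_le hn (N - n) i
  rw [Nat.add_sub_cancel' hnN] at h
  exact (sqrt_sub_sqrt_sq_le (S.pathVar_nonneg _ _ _) (S.pathVar_le hn _ i)).trans h

/-- The variance of the imputed parameter in the limit. -/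
def pathVarLim (n : ℕ) (i : ℕ ⊕ P) : ℝ := ∑' l, S.gain (n + l + 1) i ^ 2

theorem summable_gain_sq {n : ℕ} (hn : 1 ≤ n) (i : ℕ ⊕ P) :
    Summable fun l => S.gain (n + l + 1) i ^ 2 :=
  summable_of_sum_range_le (fun _ => sq_nonneg _) fun k => S.pathVar_le hn k i

theorem tendsto_pathVar {n : ℕ} (hn : 1 ≤ n) (i : ℕ ⊕ P) :
    Tendsto (fun k => S.pathVar n k i) atTop (𝓝 (S.pathVarLim n i)) :=
  (S.summable_gain_sq hn i).hasSum.tendsto_sum_nat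

theorem pathVarLim_nonneg (n : ℕ) (i : ℕ ⊕ P) : 0 ≤ S.pathVarLim n i :=
  tsum_nonneg fun _ => sq_nonneg _

theorem pathVarLim_le {n : ℕ} (hn : 1 ≤ n) (i : ℕ ⊕ P) : S.pathVarLim n i ≤ S.postVar n i :=
  le_of_tendsto' (S.tendsto_pathVar hn i) fun k => S.pathVar_le hn k i

theorem tendsto_postVar (i : ℕ) : Tendsto (fun j => S.postVar j (Sum.inl i)) atTop (𝓝 0) := by
  have hs : 0 < S.s i ^ 2 := pow_pos (S.s_pos i) 2
  have h : Tendsto (fun j : ℕ => 1 + (j : ℝ) * S.s i ^ 2) atTop atTop :=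
    tendsto_atTop_add_const_left _ _ (tendsto_natCast_atTop_atTop.atTop_mul_const hs)
  simpa only [postVar, one_div] using! h.inv_tendsto_atTop

/-- Let the remaining variance `V_{n+k}` tend to zero. This is confined to positive singular values:
in kernel directions the variance never decreases. -/
theorem postVar_sub_pathVarLim_le {n : ℕ} (hn : 1 ≤ n) (i : ℕ) :
    S.postVar n (Sum.inl i) - S.pathVarLim n (Sum.inl i) ≤ S.postVar n (Sum.inl i) / n := by
  have h1 := (S.tendsto_pathVar hn (Sum.inl i)).const_sub (S.postVar n (Sum.inl i))
  have h2 := ((S.tendsto_postVar i).comp (tendsto_add_atTop_nat n)).const_add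
    (S.postVar n (Sum.inl i) / n)
  rw [add_zero] at h2
  refine le_of_tendsto_of_tendsto' h1 h2 fun k => ?_
  simpa [add_comm n] using S.postVar_sub_pathVar_le hn k (Sum.inl i)

/-- For positive `α` the norm ignores the kernel of `A`, the only place where the limiting variance
bound is unavailable. -/
theorem normWeight_inr {α : ℝ} (hα : 0 < α) (p : P) : S.normWeight α (Sum.inr p) = 0 := by
  simp [normWeight, ENNReal.zero_rpow_of_pos, hα]

theorem meanDistSq_limit_le {α : ℝ} (hα : 0 < α) {n : ℕ} (hn : 1 ≤ n)
    (R : (Fin n → ℕ ⊕ Q → ℝ) → Measure (ℕ ⊕ P → ℝ))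
    (hR : ∀ z, R z = (isoNormal (ℕ ⊕ P)).map
      fun x i => (S.model α).estimate n z i + √(S.pathVarLim n i) * x i) :
    (S.model α).meanDistSq n R ≤ (S.model α).radiusSq n / n := by
  refine (S.meanDistSq_le α n (fun i => √(S.pathVarLim n i)) _ hR).trans ?_
  rw [← S.tsum_normWeight_div α hn]
  refine ENNReal.tsum_le_tsum fun i => ?_
  rcases i with i | p
  · gcongr
    exact (sqrt_sub_sqrt_sq_le (S.pathVarLim_nonneg _ _) (S.pathVarLim_le hn _)).trans
      (S.postVar_sub_pathVarLim_le hn i)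
  · simp [S.normWeight_inr hα]

end SingularSystem

end Distance

/-! ### Square-integrable martingales -/

section Martingale

variable {Ω : Type*} {m0 : MeasurableSpace Ω} {μ : Measure Ω}
  {ℱ : Filtration ℕ m0} {f : ℕ → Ω → ℝ}

/-- Conditional Jensen for the square. -/
theorem MeasureTheory.Martingale.submartingale_sq [IsProbabilityMeasure μ] (hf : Martingale f ℱ μ) (h2 : ∀ k, MemLp (f k) 2 μ) :
    Submartingale (fun k ω => f k ω ^ 2) ℱ μ := by
  refine ⟨fun k => (hf.stronglyMeasurable k).pow 2, fun i j hij => ?_,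
    fun k => (h2 k).integrable_sq⟩
  have hJ := ConvexOn.map_condExp_le_univ (ℱ.le i) (f := f j) (φ := fun t : ℝ => t ^ 2)
    (even_two.convexOn_pow) (continuous_pow 2).lowerSemicontinuous (hf.integrable j)
    (h2 j).integrable_sq
  filter_upwards [hJ, hf.condExp_ae_eq hij] with ω h1 h3
  rw [Function.comp_apply, h3] at h1
  exact h1

/-- Increments are orthogonal to the past, so the cross term equals the second moment at the earlier
time. -/
theorem MeasureTheory.Martingale.integral_sub_sq [IsProbabilityMeasure μ] (hf : Martingale f ℱ μ) (h2 : ∀ k, MemLp (f k) 2 μ) {i j : ℕ}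
    (hij : i ≤ j) :
    ∫ ω, (f j ω - f i ω) ^ 2 ∂μ = ∫ ω, f j ω ^ 2 ∂μ - ∫ ω, f i ω ^ 2 ∂μ := by
  have hint : Integrable (f i * f j) μ := (h2 i).integrable_mul (h2 j)
  have h1 : ∫ ω, (f i * f j) ω ∂μ = ∫ ω, f i ω ^ 2 ∂μ := by
    rw [← integral_condExp (ℱ.le i)]
    refine integral_congr_ae ?_
    filter_upwards [condExp_mul_of_stronglyMeasurable_left (hf.stronglyMeasurable i) hint
      (hf.integrable j), hf.condExp_ae_eq hij] with ω h3 h4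
    rw [h3, Pi.mul_apply, h4]
    ring
  have e : ∀ ω, (f j ω - f i ω) ^ 2 = f j ω ^ 2 - 2 * (f i * f j) ω + f i ω ^ 2 := fun ω => by
    simp only [Pi.mul_apply]; ring
  simp only [e]
  have h3 : Integrable (fun ω => f j ω ^ 2 - 2 * (f i * f j) ω) μ :=
    (h2 j).integrable_sq.sub (hint.const_mul 2)
  rw [integral_add h3 (h2 i).integrable_sq,
    integral_sub (h2 j).integrable_sq (hint.const_mul 2), integral_const_mul, h1]
  ring

/-- The increments after time `a`. -/
theorem MeasureTheory.Martingale.increments [IsProbabilityMeasure μ] (hf : Martingale f ℱ μ) (a : ℕ) :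
    Martingale (fun k ω => f (a + k) ω - f a ω)
      ⟨fun k => ℱ (a + k), fun _ _ h => ℱ.mono (Nat.add_le_add_left h a), fun k => ℱ.le (a + k)⟩
      μ := by
  have hm : ∀ k, StronglyMeasurable[ℱ (a + k)] (f a) := fun k =>
    (hf.stronglyMeasurable a).mono (ℱ.mono (Nat.le_add_right a k))
  refine ⟨fun k => (hf.stronglyMeasurable (a + k)).sub (hm k), fun i j hij => ?_⟩
  have h1 := condExp_sub (hf.integrable (a + j)) (hf.integrable a) (ℱ (a + i))
  filter_upwards [h1, hf.condExp_ae_eq (Nat.add_le_add_left hij a)] with ω h2 h3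
  refine h2.trans ?_
  rw [Pi.sub_apply, h3, condExp_of_stronglyMeasurable (ℱ.le _) (hm i) (hf.integrable a)]

theorem submartingale_finset_sum {ι : Type*} (s : Finset ι) {F : ι → ℕ → Ω → ℝ}
    (hF : ∀ i ∈ s, Submartingale (F i) ℱ μ) :
    Submartingale (fun k ω => ∑ i ∈ s, F i k ω) ℱ μ := by
  classical
  induction s using Finset.induction_on with
  | empty => simpa using! (martingale_zero ℝ ℱ μ).submartingale
  | insert i s hi ih =>
    simp only [Finset.sum_insert hi]
    exact (hF i (Finset.mem_insert_self i s)).add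
      (ih fun j hj => hF j (Finset.mem_insert_of_mem hj))

/-- Doob's maximal inequality for a weighted sum of squares of martingale increments. -/
theorem mul_measure_sum_increments_sq_le [IsProbabilityMeasure μ] {ι : Type*} (s : Finset ι) (d : ι → ℝ)
    (hd : ∀ i, 0 ≤ d i) {F : ι → ℕ → Ω → ℝ} (hF : ∀ i, Martingale (F i) ℱ μ)
    (h2 : ∀ i k, MemLp (F i k) 2 μ) (a m : ℕ) (ε : ℝ≥0) :
    ε * μ {ω | ∃ k ≤ m, (ε : ℝ) ≤ ∑ i ∈ s, d i * (F i (a + k) ω - F i a ω) ^ 2}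
      ≤ ENNReal.ofReal
        (∑ i ∈ s, d i * (∫ ω, F i (a + m) ω ^ 2 ∂μ - ∫ ω, F i a ω ^ 2 ∂μ)) := by
  have h2' : ∀ i k, MemLp (fun ω => F i (a + k) ω - F i a ω) 2 μ := fun i k =>
    (h2 i (a + k)).sub (h2 i a)
  have hsub := submartingale_finset_sum s (F := fun i k ω => d i * (F i (a + k) ω - F i a ω) ^ 2)
    fun i _ => (((hF i).increments a).submartingale_sq (h2' i)).smul_nonneg (hd i)
  have hnn : ∀ k ω, 0 ≤ ∑ i ∈ s, d i * (F i (a + k) ω - F i a ω) ^ 2 := fun k ω =>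
    Finset.sum_nonneg fun i _ => mul_nonneg (hd i) (sq_nonneg _)
  have h := maximal_ineq hsub (fun k ω => hnn k ω) (ε := ε) m
  have e : {ω | ∃ k ≤ m, (ε : ℝ) ≤ ∑ i ∈ s, d i * (F i (a + k) ω - F i a ω) ^ 2}
      = {ω | (ε : ℝ) ≤ (Finset.range (m + 1)).sup' Finset.nonempty_range_add_one
        fun k => ∑ i ∈ s, d i * (F i (a + k) ω - F i a ω) ^ 2} := by
    ext ω
    simp [Finset.le_sup'_iff]
  rw [e]
  refine h.trans (ENNReal.ofReal_le_ofReal ?_)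
  refine (setIntegral_le_integral (hsub.integrable m) (ae_of_all _ (hnn m))).trans (le_of_eq ?_)
  rw [integral_finsetSum _ fun i _ => ((h2' i m).integrable_sq).const_mul _]
  refine Finset.sum_congr rfl fun i _ => ?_
  rw [integral_const_mul, (hF i).integral_sub_sq (h2 i) (Nat.le_add_right a m)]

end Martingale

/-! ### Convergence of the imputation path -/

section Convergence

theorem memLp_isoNormal_apply {I : Type*} (i : I) :
    MemLp (fun x : I → ℝ => x i) 2 (isoNormal I) := by
  have h := Measure.infinitePi_map_eval (fun _ : I => gaussianReal 0 1) i
  have h2 : MemLp (fun t : ℝ => t) 2 ((isoNormal I).map fun x => x i) := by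
    unfold isoNormal
    rw [h]
    exact memLp_id_gaussianReal 2
  exact (memLp_map_measure_iff (Measurable.aestronglyMeasurable (by fun_prop))
    (Measurable.aemeasurable (by fun_prop))).1 h2

theorem integral_isoNormal_sq {I : Type*} (i : I) : ∫ x, x i ^ 2 ∂isoNormal I = 1 := by
  rw [integral_eq_lintegral_of_nonneg_ae (f := fun x : I → ℝ => x i ^ 2)
    (ae_of_all _ fun x => sq_nonneg (x i))
    (Measurable.aestronglyMeasurable (by fun_prop)),
    lintegral_isoNormal_sq, ENNReal.toReal_one]

namespace SingularSystem

set_option linter.unusedSectionVars false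

variable {H Z : Type*} [NormedAddCommGroup H] [InnerProductSpace ℝ H] [CompleteSpace H]
  [NormedAddCommGroup Z] [InnerProductSpace ℝ Z] [CompleteSpace Z]
  {A : H →L[ℝ] Z} {P Q : Type*} [Countable P] [Countable Q] (S : SingularSystem A P Q) (α : ℝ)

theorem memLp_path (n k : ℕ) (θ : ℕ ⊕ P → ℝ) (i : ℕ ⊕ P) :
    MemLp (fun x => x k i - θ i) 2 ((S.model α).mpPath n θ) := by
  have h : MemLp (fun t : ℕ ⊕ P → ℝ => t i - θ i) 2
      (((S.model α).mpPath n θ).map fun x => x k) := by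
    rw [S.mpPath_map_eval α n k θ]
    refine (memLp_map_measure_iff (Measurable.aestronglyMeasurable (by fun_prop))
      (Measurable.aemeasurable (by fun_prop))).2 ?_
    refine MemLp.congr_norm ((memLp_isoNormal_apply i).const_mul √(S.pathVar n k i))
      (Measurable.aestronglyMeasurable (by fun_prop)) (ae_of_all _ fun x => ?_)
    simp
  exact (memLp_map_measure_iff (Measurable.aestronglyMeasurable (by fun_prop))
      (Measurable.aemeasurable (by fun_prop))).1 h

theorem integral_path_sq (n k : ℕ) (θ : ℕ ⊕ P → ℝ) (i : ℕ ⊕ P) :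
    ∫ x, (x k i - θ i) ^ 2 ∂(S.model α).mpPath n θ = S.pathVar n k i := by
  rw [← integral_map (φ := fun x : ℕ → ℕ ⊕ P → ℝ => x k) (f := fun t => (t i - θ i) ^ 2)
    (Measurable.aemeasurable (by fun_prop)) (Measurable.aestronglyMeasurable (by fun_prop)),
    S.mpPath_map_eval α n k θ, integral_map (Measurable.aemeasurable (by fun_prop))
    (Measurable.aestronglyMeasurable (by fun_prop))]
  simp only [add_sub_cancel_left, mul_pow, Real.sq_sqrt (S.pathVar_nonneg n k i)]
  rw [integral_const_mul, integral_isoNormal_sq, mul_one]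

theorem integral_stepKernel {j : ℕ} (hj : 1 ≤ j) (t θ : ℕ ⊕ P → ℝ) (i : ℕ ⊕ P) :
    ∫ y, (y i - θ i) ∂(S.model α).stepKernel j t = t i - θ i := by
  rw [S.stepKernel_apply α hj, integral_map (Measurable.aemeasurable (by fun_prop))
    (Measurable.aestronglyMeasurable (by fun_prop))]
  have e : ∀ x : ℕ ⊕ P → ℝ, t i + S.gain j i * x i - θ i = (t i - θ i) + S.gain j i * x i :=
    fun x => by ring
  simp only [e]
  rw [integral_add (integrable_const _) ((integrable_isoNormal_apply i).const_mul _),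
    integral_const_mul, integral_isoNormal_apply]
  simp

theorem martingale_path (n : ℕ) (θ : ℕ ⊕ P → ℝ) (i : ℕ ⊕ P) :
    Martingale (fun k x => x k i - θ i) (Filtration.piLE (X := fun _ => ℕ ⊕ P → ℝ))
      ((S.model α).mpPath n θ) := by
  have hint : ∀ k, Integrable (fun x : ℕ → ℕ ⊕ P → ℝ => x k i - θ i) ((S.model α).mpPath n θ) :=
    fun k => (S.memLp_path α n k θ i).integrable one_le_two
  refine martingale_nat (fun k => ?_) hint fun k => ?_
  · rw [Filtration.piLE_eq_comap_frestrictLe]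
    have h1 : Measurable fun h : (l : Finset.Iic k) → ℕ ⊕ P → ℝ =>
        h ⟨k, Finset.mem_Iic.2 le_rfl⟩ i - θ i := by fun_prop
    exact (h1.comp (comap_measurable _)).stronglyMeasurable
  · have h := Kernel.condExp_traj (X := fun _ => ℕ ⊕ P → ℝ) (κ := (S.model α).pathKernel n)
      (Nat.zero_le k) (x₀ := fun _ => θ) (hint (k + 1))
    rw [← MPModel.mpPath_eq_traj] at h
    filter_upwards [h] with x hx
    rw [hx, ← integral_map (φ := fun x : ℕ → ℕ ⊕ P → ℝ => x (k + 1)) (f := fun t => t i - θ i)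
      (Measurable.aemeasurable (by fun_prop)) (Measurable.aestronglyMeasurable (by fun_prop)),
      ← Kernel.map_apply _ (by fun_prop), Kernel.map_traj_succ_self]
    exact (S.integral_stepKernel α (by omega) (x k) θ i).symm

/-- Each centred coordinate is a martingale with variance at most `V_n`. The bound `|t| ≤ 1 + t²`
makes it bounded in `L¹`, and there are countably many coordinates. -/
theorem ae_tendsto_path {n : ℕ} (hn : 1 ≤ n) (θ : ℕ ⊕ P → ℝ) :
    ∀ᵐ x ∂(S.model α).mpPath n θ, Tendsto x atTop (𝓝 (MPModel.pathLimit x)) := by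
  have h : ∀ i, ∀ᵐ x ∂(S.model α).mpPath n θ, ∃ c, Tendsto (fun k => x k i - θ i) atTop (𝓝 c) := by
    intro i
    refine (S.martingale_path α n θ i).submartingale.exists_ae_tendsto_of_bdd
      (R := (1 + S.postVar n i).toNNReal) fun k => ?_
    have hsq := (S.memLp_path α n k θ i).integrable_sq
    have h1 : ∀ t : ℝ, ‖t‖ ≤ 1 + t ^ 2 := fun t => by
      rw [Real.norm_eq_abs, ← sq_abs]; nlinarith [sq_nonneg (|t| - 1), abs_nonneg t]
    have h2 : ∫ x, ‖x k i - θ i‖ ∂(S.model α).mpPath n θ ≤ 1 + S.postVar n i := by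
      refine (integral_mono ((S.memLp_path α n k θ i).integrable one_le_two).norm
        ((integrable_const 1).add hsq) fun x => h1 _).trans ?_
      have h3 := integral_add (integrable_const (μ := (S.model α).mpPath n θ) (1 : ℝ)) hsq
      refine (le_of_eq h3).trans ?_
      rw [S.integral_path_sq α n k θ i]
      simpa using S.pathVar_le hn k i
    rw [eLpNorm_one_eq_lintegral_enorm, ← ofReal_integral_norm_eq_lintegral_enorm
      ((S.memLp_path α n k θ i).integrable one_le_two)]
    exact ENNReal.ofReal_le_ofReal h2
  filter_upwards [ae_all_iff.2 h] with x hx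
  refine tendsto_pi_nhds.2 fun i => ?_
  obtain ⟨c, hc⟩ := hx i
  have h3 : Tendsto (fun k => x k i) atTop (𝓝 (c + θ i)) := by
    simpa using hc.add_const (θ i)
  exact tendsto_nhds_limUnder ⟨_, h3⟩

/-- Without this, the image measure under `pathLimit` would be zero by convention. -/
theorem aemeasurable_pathLimit {n : ℕ} (hn : 1 ≤ n) (θ : ℕ ⊕ P → ℝ) :
    AEMeasurable MPModel.pathLimit ((S.model α).mpPath n θ) :=
  aemeasurable_of_tendsto_metrizable_ae' (fun k => (measurable_pi_apply k).aemeasurable)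
    (S.ae_tendsto_path α hn θ)

/-- Almost sure convergence and the convergence of the explicit Gaussian marginals yield two limits
of the same integrals of bounded continuous functions, and these determine a law. -/
theorem mpPath_map_pathLimit {n : ℕ} (hn : 1 ≤ n) (θ : ℕ ⊕ P → ℝ) :
    ((S.model α).mpPath n θ).map MPModel.pathLimit
      = (isoNormal (ℕ ⊕ P)).map fun x i => θ i + √(S.pathVarLim n i) * x i := by
  have hm := S.aemeasurable_pathLimit α hn θ
  have hg : ∀ k, Measurable fun (x : ℕ ⊕ P → ℝ) i => θ i + √(S.pathVar n k i) * x i := fun k => by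
    fun_prop
  have hg' : Measurable fun (x : ℕ ⊕ P → ℝ) i => θ i + √(S.pathVarLim n i) * x i := by fun_prop
  have := Measure.isProbabilityMeasure_map hm
  have := Measure.isProbabilityMeasure_map (μ := isoNormal (ℕ ⊕ P)) hg'.aemeasurable
  refine ext_of_forall_integral_eq_of_IsFiniteMeasure fun f => ?_
  have hf : Measurable f := f.continuous.measurable
  rw [integral_map hm hf.aestronglyMeasurable, integral_map hg'.aemeasurable hf.aestronglyMeasurable]
  have h1 : Tendsto (fun k => ∫ x, f (x k) ∂(S.model α).mpPath n θ) atTop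
      (𝓝 (∫ x, f (MPModel.pathLimit x) ∂(S.model α).mpPath n θ)) := by
    refine tendsto_integral_of_dominated_convergence (fun _ => ‖f‖)
      (fun k => (hf.comp (measurable_pi_apply k)).aestronglyMeasurable) (integrable_const _)
      (fun k => ae_of_all _ fun x => f.norm_coe_le_norm _) ?_
    filter_upwards [S.ae_tendsto_path α hn θ] with x hx
    exact (f.continuous.tendsto _).comp hx
  have h2 : Tendsto (fun k => ∫ x, f (fun i => θ i + √(S.pathVar n k i) * x i)
      ∂isoNormal (ℕ ⊕ P)) atTop
      (𝓝 (∫ x, f (fun i => θ i + √(S.pathVarLim n i) * x i) ∂isoNormal (ℕ ⊕ P))) := by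
    refine tendsto_integral_of_dominated_convergence (fun _ => ‖f‖)
      (fun k => (hf.comp (hg k)).aestronglyMeasurable) (integrable_const _)
      (fun k => ae_of_all _ fun x => f.norm_coe_le_norm _) (ae_of_all _ fun x => ?_)
    refine (f.continuous.tendsto _).comp (tendsto_pi_nhds.2 fun i => ?_)
    exact (((Real.continuous_sqrt.tendsto _).comp (S.tendsto_pathVar hn i)).mul_const _).const_add _
  refine tendsto_nhds_unique h1 (h2.congr fun k => ?_)
  rw [← integral_map (φ := fun x : ℕ → ℕ ⊕ P → ℝ => x k) (f := f)
    (measurable_pi_apply k).aemeasurable hf.aestronglyMeasurable, S.mpPath_map_eval α n k θ,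
    integral_map (hg k).aemeasurable hf.aestronglyMeasurable]

theorem meanDistSq_mpLawInf_le {α : ℝ} (hα : 0 < α) {n : ℕ} (hn : 1 ≤ n) :
    (S.model α).meanDistSq n ((S.model α).mpLawInf n) ≤ (S.model α).radiusSq n / n :=
  S.meanDistSq_limit_le hα hn _ fun _ => S.mpPath_map_pathLimit α hn _

end SingularSystem

end Convergence

/-! ### Almost sure convergence of the imputation path in norm -/

section NormConvergence

namespace SingularSystem

set_option linter.unusedSectionVars false

variable {H Z : Type*} [NormedAddCommGroup H] [InnerProductSpace ℝ H] [CompleteSpace H]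
  [NormedAddCommGroup Z] [InnerProductSpace ℝ Z] [CompleteSpace Z]
  {A : H →L[ℝ] Z} {P Q : Type*} [Countable P] [Countable Q] (S : SingularSystem A P Q) {α : ℝ}

theorem normWeight_inl (α : ℝ) (i : ℕ) :
    S.normWeight α (Sum.inl i) = ENNReal.ofReal (S.s i ^ (2 * α)) := by
  rw [normWeight, weight_inl, ENNReal.ofReal_rpow_of_pos (S.s_pos i)]

theorem normWeight_ne_top (hα : 0 < α) (i : ℕ ⊕ P) : S.normWeight α i ≠ ∞ := by
  rcases i with i | p
  · rw [normWeight_inl]; exact ENNReal.ofReal_ne_top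
  · rw [S.normWeight_inr hα]; exact ENNReal.zero_ne_top

theorem tsum_normWeight_mul (hα : 0 < α) (g : ℕ ⊕ P → ℝ≥0∞) :
    ∑' i, S.normWeight α i * g i = ∑' i : ℕ, S.normWeight α (Sum.inl i) * g (Sum.inl i) := by
  rw [ENNReal.summable.tsum_sum ENNReal.summable]
  simp [S.normWeight_inr hα]

theorem nrm_sq_eq_tsum_nat (hα : 0 < α) (x : ℕ ⊕ P → ℝ) : (S.model α).nrm x ^ 2
    = ∑' i : ℕ, ENNReal.ofReal (S.s i ^ (2 * α) * x (Sum.inl i) ^ 2) := by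
  rw [nrm_sq, S.tsum_normWeight_mul hα]
  refine tsum_congr fun i => ?_
  rw [normWeight_inl, ENNReal.ofReal_mul (Real.rpow_nonneg (S.s_pos i).le _)]

theorem radiusSq_eq_tsum_nat (hα : 0 < α) (j : ℕ) : (S.model α).radiusSq j
    = ∑' i : ℕ, ENNReal.ofReal (S.s i ^ (2 * α) * S.postVar j (Sum.inl i)) := by
  rw [radiusSq_eq, S.tsum_normWeight_mul hα]
  refine tsum_congr fun i => ?_
  rw [normWeight_inl, ENNReal.ofReal_mul (Real.rpow_nonneg (S.s_pos i).le _)]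

/-- The variance gained after `a` steps is that of a path started at time `n + a`. -/
theorem pathVar_add_sub (n a m : ℕ) (i : ℕ ⊕ P) :
    S.pathVar n (a + m) i - S.pathVar n a i = S.pathVar (n + a) m i := by
  simp only [pathVar, Finset.sum_range_add, add_sub_cancel_left, add_assoc]

/-- The maximal inequality for the imputation path. -/
theorem mul_measure_exists_lt_nrm_sq_le (hα : 0 < α) {n : ℕ} (hn : 1 ≤ n) (θ : ℕ ⊕ P → ℝ) (a : ℕ)
    (ε : ℝ≥0) :
    ε * (S.model α).mpPath n θ {x | ∃ k, ε < (S.model α).nrm (x (a + k) - x a) ^ 2}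
      ≤ (S.model α).radiusSq (n + a) := by
  -- One index truncates both time and the coordinate sum, so the events increase and each involves
  -- a finite sum to which Doob's inequality applies.
  set B : ℕ → Set (ℕ → ℕ ⊕ P → ℝ) := fun m => {x | ∃ k ≤ m, (ε : ℝ) ≤ ∑ i ∈ Finset.range m,
    S.s i ^ (2 * α) * (x (a + k) (Sum.inl i) - x a (Sum.inl i)) ^ 2} with hB
  have hd : ∀ i, 0 ≤ S.s i ^ (2 * α) := fun i => Real.rpow_nonneg (S.s_pos i).le _
  have hmono : Monotone B := fun m m' h x ⟨k, hk, hx⟩ => ⟨k, hk.trans h, hx.trans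
    (Finset.sum_le_sum_of_subset_of_nonneg (Finset.range_mono h)
      fun i _ _ => mul_nonneg (hd i) (sq_nonneg _))⟩
  have hsub : {x | ∃ k, ε < (S.model α).nrm (x (a + k) - x a) ^ 2} ⊆ ⋃ m, B m := by
    rintro x ⟨k, hk⟩
    rw [S.nrm_sq_eq_tsum_nat hα, ENNReal.tsum_eq_iSup_nat, lt_iSup_iff] at hk
    obtain ⟨m, hm⟩ := hk
    rw [← ENNReal.ofReal_sum_of_nonneg fun i _ => mul_nonneg (hd i) (sq_nonneg _),
      ENNReal.lt_ofReal_iff_toReal_lt ENNReal.coe_ne_top, ENNReal.coe_toReal] at hm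
    exact Set.mem_iUnion.2 ⟨max k m, hmono (le_max_right k m) |> fun _ =>
      ⟨k, le_max_left k m, hm.le.trans (Finset.sum_le_sum_of_subset_of_nonneg
        (Finset.range_mono (le_max_right k m)) fun i _ _ => mul_nonneg (hd i) (sq_nonneg _))⟩⟩
  refine (mul_le_mul_right (measure_mono hsub) _).trans ?_
  rw [hmono.measure_iUnion, ENNReal.mul_iSup]
  refine iSup_le fun m => ?_
  have h := mul_measure_sum_increments_sq_le (Finset.range m) (fun i => S.s i ^ (2 * α)) hd
    (fun i => S.martingale_path α n θ (Sum.inl i)) (fun i k => S.memLp_path α n k θ (Sum.inl i))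
    a m ε
  simp only [sub_sub_sub_cancel_right, integral_path_sq, pathVar_add_sub] at h
  refine h.trans ?_
  rw [S.radiusSq_eq_tsum_nat hα, ENNReal.ofReal_sum_of_nonneg
    fun i _ => mul_nonneg (hd i) (S.pathVar_nonneg _ _ _)]
  refine (Finset.sum_le_sum fun i _ => ?_).trans (ENNReal.sum_le_tsum (Finset.range m))
  exact ENNReal.ofReal_le_ofReal
    (mul_le_mul_of_nonneg_left (S.pathVar_le (hn.trans (Nat.le_add_right n a)) m _) (hd i))

/-- The bad event lies in the event that `ε` is exceeded after time `a`, for every `a`; those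
probabilities are at most `ε_{n+a}² / ε`. -/
theorem ae_exists_forall_nrm_sq_le (hα : 0 < α) {n : ℕ} (hn : 1 ≤ n)
    (hr : Tendsto (S.model α).radiusSq atTop (𝓝 0)) (θ : ℕ ⊕ P → ℝ) {ε : ℝ≥0} (hε : 0 < ε) :
    ∀ᵐ x ∂(S.model α).mpPath n θ, ∃ a, ∀ k, (S.model α).nrm (x (a + k) - x a) ^ 2 ≤ ε := by
  have h : ∀ a, (S.model α).mpPath n θ
      {x | ¬ ∃ a, ∀ k, (S.model α).nrm (x (a + k) - x a) ^ 2 ≤ ε}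
      ≤ (S.model α).radiusSq (a + n) / ε := by
    intro a
    rw [ENNReal.le_div_iff_mul_le (Or.inl (by exact_mod_cast hε.ne')) (Or.inl ENNReal.coe_ne_top),
      mul_comm, add_comm a n]
    refine (mul_le_mul_right (measure_mono ?_) _).trans
      (S.mul_measure_exists_lt_nrm_sq_le hα hn θ a ε)
    intro x hx
    simp only [Set.mem_ofPred_eq, not_exists, not_forall, not_le] at hx
    exact hx a
  have h2 : Tendsto (fun a => (S.model α).radiusSq (a + n) / ε) atTop (𝓝 0) := by
    have := ENNReal.Tendsto.div_const (hr.comp (tendsto_add_atTop_nat n))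
      (b := (ε : ℝ≥0∞)) (Or.inr (by exact_mod_cast hε.ne'))
    rwa [ENNReal.zero_div] at this
  exact le_antisymm (ge_of_tendsto' h2 h) zero_le

theorem nrm_sub_sq_le (x y z : ℕ ⊕ P → ℝ) : (S.model α).nrm (x - z) ^ 2
    ≤ 2 * (S.model α).nrm (x - y) ^ 2 + 2 * (S.model α).nrm (y - z) ^ 2 := by
  simp only [nrm_sq, ← ENNReal.tsum_mul_left, ← ENNReal.tsum_add]
  refine ENNReal.tsum_le_tsum fun i => ?_
  rw [mul_left_comm, mul_left_comm 2, ← mul_add]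
  gcongr
  rw [← ENNReal.ofReal_ofNat, ← ENNReal.ofReal_mul zero_le_two, ← ENNReal.ofReal_mul zero_le_two,
    ← ENNReal.ofReal_add (by positivity) (by positivity)]
  refine ENNReal.ofReal_le_ofReal ?_
  simp only [Pi.sub_apply]
  nlinarith [sq_nonneg (x i - y i - (y i - z i))]

/-- Lower semicontinuity under coordinatewise convergence, through finite partial sums; `α > 0`
keeps the weights finite. -/
theorem nrm_sq_le_of_tendsto (hα : 0 < α) {x : ℕ → ℕ ⊕ P → ℝ} {y : ℕ ⊕ P → ℝ} {c : ℝ≥0∞}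
    (hx : Tendsto x atTop (𝓝 y)) (h : ∀ k, (S.model α).nrm (x k) ^ 2 ≤ c) :
    (S.model α).nrm y ^ 2 ≤ c := by
  simp only [nrm_sq] at h ⊢
  rw [ENNReal.tsum_eq_iSup_sum]
  refine iSup_le fun s => ?_
  have ht : Tendsto (fun k => ∑ i ∈ s, S.normWeight α i * ENNReal.ofReal (x k i ^ 2)) atTop
      (𝓝 (∑ i ∈ s, S.normWeight α i * ENNReal.ofReal (y i ^ 2))) := by
    refine tendsto_finsetSum _ fun i _ => ENNReal.Tendsto.const_mul ?_
      (Or.inr (S.normWeight_ne_top hα i))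
    exact ENNReal.tendsto_ofReal ((tendsto_pi_nhds.1 hx i).pow 2)
  exact le_of_tendsto' ht fun k => (ENNReal.sum_le_tsum s).trans (h k)

theorem ae_tendsto_nrm_path (hα : 0 < α) {n : ℕ} (hn : 1 ≤ n)
    (hr : Tendsto (S.model α).radiusSq atTop (𝓝 0)) (θ : ℕ ⊕ P → ℝ) :
    ∀ᵐ x ∂(S.model α).mpPath n θ,
      Tendsto (fun k => (S.model α).nrm (x k - MPModel.pathLimit x)) atTop (𝓝 0) := by
  have h1 := ae_all_iff.2 fun m : ℕ =>
    -- The factor `4` absorbs the constants `2 + 2` of `nrm_sub_sq_le`, leaving `1 / (m + 1)`.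
    S.ae_exists_forall_nrm_sq_le hα hn hr θ (ε := (4 * ((m : ℝ≥0) + 1))⁻¹) (by positivity)
  filter_upwards [h1, S.ae_tendsto_path α hn θ] with x hx hlim
  have hsq : Tendsto (fun k => (S.model α).nrm (x k - MPModel.pathLimit x) ^ 2) atTop (𝓝 0) := by
    rw [ENNReal.tendsto_nhds_zero]
    intro ε hε
    obtain ⟨m, hm⟩ := ENNReal.exists_inv_nat_lt hε.ne'
    obtain ⟨a, ha⟩ := hx m
    have hlim' : Tendsto (fun k => x (a + k) - x a) atTop (𝓝 (MPModel.pathLimit x - x a)) := by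
      refine Tendsto.sub_const ?_ _
      simpa only [add_comm a] using! hlim.comp (tendsto_add_atTop_nat a)
    have h2 := S.nrm_sq_le_of_tendsto hα hlim' ha
    filter_upwards [eventually_ge_atTop a] with k hk
    obtain ⟨l, rfl⟩ := Nat.exists_eq_add_of_le hk
    refine (S.nrm_sub_sq_le _ (x a) _).trans ?_
    rw [S.nrm_sub_comm α (x a)]
    refine (add_le_add (mul_le_mul_right (ha l) 2) (mul_le_mul_right h2 2)).trans ?_
    have e1 : 2 * (((4 * ((m : ℝ≥0) + 1))⁻¹ : ℝ≥0) : ℝ≥0∞) + 2 * ((4 * ((m : ℝ≥0) + 1))⁻¹ : ℝ≥0)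
        = (((m : ℝ≥0) + 1)⁻¹ : ℝ≥0) := by
      rw [← ENNReal.coe_ofNat, ← ENNReal.coe_mul, ← ENNReal.coe_add]
      congr 1
      field_simp
      norm_num
    rw [e1, ENNReal.coe_inv (by positivity)]
    refine le_trans (ENNReal.inv_le_inv.2 ?_) hm.le
    push_cast
    exact le_self_add
  have h3 := (ENNReal.continuous_rpow_const (y := 1 / 2)).tendsto 0 |>.comp hsq
  rw [ENNReal.zero_rpow_of_pos (by norm_num)] at h3
  refine h3.congr fun k => ?_
  rw [Function.comp_apply, ← ENNReal.rpow_natCast, ← ENNReal.rpow_mul]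
  norm_num

end SingularSystem

end NormConvergence

/-! ### The assumptions of the model -/

namespace SingularSystem

set_option linter.unusedSectionVars false

variable {H Z : Type*} [NormedAddCommGroup H] [InnerProductSpace ℝ H] [CompleteSpace H]
  [NormedAddCommGroup Z] [InnerProductSpace ℝ Z] [CompleteSpace Z]
  {A : H →L[ℝ] Z} {P Q : Type*} [Countable P] [Countable Q] (S : SingularSystem A P Q) (α : ℝ)

theorem incr_model {j : ℕ} (hj : 1 ≤ j) (θ : ℕ ⊕ P → ℝ) (z : ℕ ⊕ Q → ℝ) (i : ℕ ⊕ P) :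
    (S.model α).incr j θ z i = S.gain j i * (transfer P z i - S.weight i * θ i) := by
  rw [MPModel.incr, Pi.sub_apply, S.alg_model α hj, add_sub_cancel_left]

theorem gain_mul_weight_nonneg (j : ℕ) (i : ℕ ⊕ P) : 0 ≤ S.gain j i * S.weight i :=
  mul_nonneg (S.gain_nonneg j i) (S.weight_nonneg i)

/-- Since `g w = w² / (1 + j w²)`; this one estimate underlies all the stability conditions. -/
theorem gain_mul_weight_le {j : ℕ} (hj : 1 ≤ j) (i : ℕ ⊕ P) :
    S.gain j i * S.weight i ≤ (j : ℝ)⁻¹ := by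
  have hj' : (0 : ℝ) < j := by positivity
  rw [gain, div_mul_eq_mul_div, div_le_iff₀ (by positivity)]
  field_simp
  linarith

/-- The innovation has mean `w (θ' - θ)` when the data come from `θ'`. -/
theorem integrable_incr_and_integral {j : ℕ} (hj : 1 ≤ j) (θ' θ : ℕ ⊕ P → ℝ) (i : ℕ ⊕ P) :
    Integrable (fun z => (S.model α).incr j θ z i) ((S.model α).lik θ') ∧
    (S.model α).meanIncr j θ' θ i = S.gain j i * S.weight i * (θ' i - θ i) := by
  have hf : Measurable fun y : ℕ ⊕ Q → ℝ => S.fwd θ' + y := by fun_prop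
  simp only [MPModel.meanIncr, S.incr_model α hj, lik_model]
  rcases i with l | p
  · simp only [transfer_inl, weight_inl]
    have hm : Measurable fun z : ℕ ⊕ Q → ℝ =>
        S.gain j (Sum.inl l) * (z (Sum.inl l) - S.s l * θ (Sum.inl l)) := by fun_prop
    have hi : Integrable (fun y : ℕ ⊕ Q → ℝ => S.gain j (Sum.inl l)
        * ((S.fwd θ' + y) (Sum.inl l) - S.s l * θ (Sum.inl l))) (isoNormal (ℕ ⊕ Q)) :=
      (((integrable_const _).add (integrable_isoNormal_apply _)).sub
        (integrable_const _)).const_mul _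
    refine ⟨(integrable_map_measure hm.aestronglyMeasurable hf.aemeasurable).2 hi, ?_⟩
    rw [integral_map hf.aemeasurable hm.aestronglyMeasurable]
    simp only [Pi.add_apply, fwd_inl]
    have hx := integrable_isoNormal_apply (Sum.inl l : ℕ ⊕ Q)
    rw [integral_const_mul, integral_sub (f := fun y : ℕ ⊕ Q → ℝ => _ + y (Sum.inl l))
      ((integrable_const _).add hx) (integrable_const _), integral_add (integrable_const _) hx,
      integral_isoNormal_apply]
    simp only [integral_const, probReal_univ, smul_eq_mul]
    ring
  · simp

theorem meanIncr_eq {j : ℕ} (hj : 1 ≤ j) (θ' θ : ℕ ⊕ P → ℝ) :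
    (S.model α).meanIncr j θ' θ = fun i => S.gain j i * S.weight i * (θ' i - θ i) :=
  funext fun i => (S.integrable_incr_and_integral α hj θ' θ i).2

theorem nrm_sq_zero : (S.model α).nrm 0 ^ 2 = 0 := by simp [nrm_sq]

theorem nrm_sq_mul_le {a : ℕ ⊕ P → ℝ} {c : ℝ} (h : ∀ i, a i ^ 2 ≤ c) (x : ℕ ⊕ P → ℝ) :
    (S.model α).nrm (fun i => a i * x i) ^ 2 ≤ ENNReal.ofReal c * (S.model α).nrm x ^ 2 := by
  simp only [nrm_sq, ← ENNReal.tsum_mul_left]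
  refine ENNReal.tsum_le_tsum fun i => ?_
  rw [mul_left_comm, ← ENNReal.ofReal_mul' (sq_nonneg _), mul_pow]
  gcongr
  exact h i

theorem approxMartingale {n : ℕ} (hn : 1 ≤ n) {δ : ℝ} (hδ : 0 < δ) :
    (S.model α).ApproxMartingale n δ := by
  refine ⟨hδ, fun j hj θ => ⟨fun i => (S.integrable_incr_and_integral α (hn.trans hj) θ θ i).1, ?_⟩⟩
  have h : (S.model α).meanIncr j θ θ = 0 := by
    rw [S.meanIncr_eq α (hn.trans hj)]
    funext i
    simp
  rw [h, nrm_sq_zero]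
  exact zero_le

theorem nrm_incr_sub_left_le {j : ℕ} (hj : 1 ≤ j) (θ θ' : ℕ ⊕ P → ℝ) (z : ℕ ⊕ Q → ℝ) :
    (S.model α).nrm ((S.model α).incr j θ z - (S.model α).incr j θ' z) ^ 2
      ≤ ENNReal.ofReal ((j : ℝ)⁻¹ ^ 2) * (S.model α).nrm (θ - θ') ^ 2 := by
  have h : (S.model α).incr j θ z - (S.model α).incr j θ' z
      = fun i => -(S.gain j i * S.weight i) * (θ - θ') i := by
    funext i
    simp only [Pi.sub_apply, S.incr_model α hj]
    ring
  rw [h]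
  refine S.nrm_sq_mul_le α (fun i => ?_) _
  rw [neg_sq]
  exact pow_le_pow_left₀ (S.gain_mul_weight_nonneg j i) (S.gain_mul_weight_le hj i) 2

/-- The weights of the squared norm on data. -/
def normWeightZ (k : ℕ ⊕ Q) : ℝ≥0∞ :=
  ENNReal.ofReal (Sum.elim S.s (fun _ => 0) k) ^ (2 * (α - 1))

/-- The exponents `α` and `α - 1` differ by one factor `w²`, so `A` is isometric in positive
singular directions. The identity can fail for `w = 0`, hence the separate treatment of the kernels.
-/
theorem normWeight_inl_eq (l : ℕ) : S.normWeight α (Sum.inl l)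
    = S.normWeightZ α (Sum.inl l) * ENNReal.ofReal (S.s l ^ 2) := by
  have hs := S.s_pos l
  rw [normWeight_inl, normWeightZ, Sum.elim_inl, ENNReal.ofReal_rpow_of_pos hs,
    ← ENNReal.ofReal_mul (Real.rpow_nonneg hs.le _), ← Real.rpow_natCast, ← Real.rpow_add hs]
  congr 2
  push_cast
  ring

theorem nrm_sq_of_inr_eq_zero {x : ℕ ⊕ P → ℝ} (hx : ∀ p, x (Sum.inr p) = 0) :
    (S.model α).nrm x ^ 2
      = ∑' l : ℕ, S.normWeight α (Sum.inl l) * ENNReal.ofReal (x (Sum.inl l) ^ 2) := by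
  rw [nrm_sq, ENNReal.summable.tsum_sum ENNReal.summable]
  simp [hx]

theorem tsum_inl_le_nrm_sq (x : ℕ ⊕ P → ℝ) :
    ∑' l : ℕ, S.normWeight α (Sum.inl l) * ENNReal.ofReal (x (Sum.inl l) ^ 2)
      ≤ (S.model α).nrm x ^ 2 := by
  rw [nrm_sq, ENNReal.summable.tsum_sum ENNReal.summable]
  exact le_self_add

theorem nrmZ_sq_of_inr_eq_zero {z : ℕ ⊕ Q → ℝ} (hz : ∀ q, z (Sum.inr q) = 0) :
    (S.model α).nrmZ z ^ 2
      = ∑' l : ℕ, S.normWeightZ α (Sum.inl l) * ENNReal.ofReal (z (Sum.inl l) ^ 2) := by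
  rw [nrmZ_sq, ENNReal.summable.tsum_sum ENNReal.summable]
  simp [hz, normWeightZ]

theorem tsum_inl_le_nrmZ_sq (z : ℕ ⊕ Q → ℝ) :
    ∑' l : ℕ, S.normWeightZ α (Sum.inl l) * ENNReal.ofReal (z (Sum.inl l) ^ 2)
      ≤ (S.model α).nrmZ z ^ 2 := by
  rw [nrmZ_sq, ENNReal.summable.tsum_sum ENNReal.summable]
  exact le_self_add

theorem nrm_incr_sub_right_le {j : ℕ} (hj : 1 ≤ j) (θ : ℕ ⊕ P → ℝ) (z z' : ℕ ⊕ Q → ℝ) :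
    (S.model α).nrm ((S.model α).incr j θ z - (S.model α).incr j θ z') ^ 2
      ≤ ENNReal.ofReal ((j : ℝ)⁻¹ ^ 2) * (S.model α).nrmZ (z - z') ^ 2 := by
  rw [S.nrm_sq_of_inr_eq_zero α fun p => by simp [S.incr_model α hj]]
  refine le_trans ?_ (mul_le_mul_right (S.tsum_inl_le_nrmZ_sq α (z - z')) _)
  rw [← ENNReal.tsum_mul_left]
  refine ENNReal.tsum_le_tsum fun l => ?_
  rw [normWeight_inl_eq, mul_assoc, mul_left_comm (ENNReal.ofReal _),
    ← ENNReal.ofReal_mul (sq_nonneg _), ← ENNReal.ofReal_mul (sq_nonneg _)]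
  refine mul_le_mul_right (ENNReal.ofReal_le_ofReal ?_) _
  have h := pow_le_pow_left₀ (S.gain_mul_weight_nonneg j (Sum.inl l))
    (S.gain_mul_weight_le hj (Sum.inl l)) 2
  have e : S.s l ^ 2 * ((S.model α).incr j θ z - (S.model α).incr j θ z') (Sum.inl l) ^ 2
      = (S.gain j (Sum.inl l) * S.weight (Sum.inl l)) ^ 2 * (z - z') (Sum.inl l) ^ 2 := by
    simp only [Pi.sub_apply, S.incr_model α hj, transfer_inl, weight_inl]
    ring
  rw [e]
  exact mul_le_mul_of_nonneg_right h (sq_nonneg _)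

theorem nrmZ_fwd_sub_le (θ θ' : ℕ ⊕ P → ℝ) :
    (S.model α).nrmZ (S.fwd θ - S.fwd θ') ^ 2 ≤ (S.model α).nrm (θ - θ') ^ 2 := by
  rw [S.nrmZ_sq_of_inr_eq_zero α fun q => by simp [fwd_inr]]
  refine le_trans (ENNReal.tsum_le_tsum fun l => ?_) (S.tsum_inl_le_nrm_sq α (θ - θ'))
  rw [normWeight_inl_eq, mul_assoc, ← ENNReal.ofReal_mul (sq_nonneg _), ← mul_pow]
  simp only [Pi.sub_apply, fwd_inl, mul_sub, le_refl]

/-- With common noise the two observations differ by the deterministic vector `A θ - A θ'`. -/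
theorem wassersteinSq_lik_le (θ θ' : ℕ ⊕ P → ℝ) :
    wassersteinSq (S.model α).nrmZ ((S.model α).lik θ) ((S.model α).lik θ')
      ≤ (S.model α).nrm (θ - θ') ^ 2 := by
  have hm : Measurable fun y : ℕ ⊕ Q → ℝ => (S.fwd θ + y, S.fwd θ' + y) := by fun_prop
  refine (iInf₂_le ((isoNormal (ℕ ⊕ Q)).map fun y => (S.fwd θ + y, S.fwd θ' + y)) ⟨?_, ?_⟩).trans ?_
  rotate_left
  · rw [Measure.map_map measurable_fst hm, lik_model]; rfl
  · rw [Measure.map_map measurable_snd hm, lik_model]; rfl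
  · refine (lintegral_map_le _ _).trans ?_
    simp only [add_sub_add_right_eq_sub, lintegral_const, measure_univ, mul_one]
    exact S.nrmZ_fwd_sub_le α θ θ'

theorem stabilityI {n : ℕ} (hn : 1 ≤ n) (N : ℕ∞) {ι : ℝ} (hι : 0 < ι) (hι' : ι ≤ 1) :
    (S.model α).StabilityI n N (fun j => (j : ℝ)⁻¹) ι 1 1 1 := by
  refine ⟨hι, one_pos, one_pos, fun j hj _ => ⟨by positivity, ?_, ?_, ?_⟩, Or.inl ?_⟩
  · have hj' : (1 : ℝ) ≤ j := by exact_mod_cast hn.trans hj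
    beta_reduce
    rw [← Real.rpow_neg_one]
    -- Here `ι ≤ 1` enters: it gives `-1 ≤ -(1 + ι) / 2`.
    exact Real.rpow_le_rpow_of_exponent_le hj' (by linarith)
  · simpa using! S.nrm_incr_sub_left_le α (hn.trans hj)
  · simpa using! S.nrm_incr_sub_right_le α (hn.trans hj)
  · simpa using! S.wassersteinSq_lik_le α

theorem efficiency (n : ℕ) (N : ℕ∞) {δ ι s : ℝ} {ν : ℕ → ℝ≥0} (hs : 0 < s) (hs' : s < min δ ι)
    (hν : Tendsto ν atTop (𝓝 0)) : (S.model α).Efficiency n N δ ι s ν :=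
  ⟨hs, hs', hν, fun j _ _ => by rw [excessSq_eq_zero]; exact zero_le⟩

theorem stabilityII : (S.model α).StabilityII (fun j => (j : ℝ)⁻¹) 0 1 := by
  -- The factor `j` cancels `η_j`, so the drift of step `j + 1` is reproduced exactly; the
  -- multiplier is at most `j / (j + 1)`.
  refine ⟨le_rfl, zero_le_one, fun _ j =>
    { toFun := fun x i => (j * (S.gain (j + 1) i * S.weight i)) * x i
      map_add' := fun x y => by funext i; simp only [Pi.add_apply]; ring
      map_smul' := fun c x => by
        funext i; simp only [Pi.smul_apply, smul_eq_mul, RingHom.id_apply]; ring },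
    fun θ θ' j hj => ⟨fun i =>
      (S.integrable_incr_and_integral α (Nat.le_add_left 1 j) θ' θ i).1, ?_, fun x => ?_⟩⟩
  · rw [S.meanIncr_eq α (Nat.le_add_left 1 j)]
    have hj' : (j : ℝ) ≠ 0 := by positivity
    have h : (fun i => S.gain (j + 1) i * S.weight i * (θ' i - θ i)) - (j : ℝ)⁻¹ •
        (fun i => (j * (S.gain (j + 1) i * S.weight i)) * (θ' - θ) i) = 0 := by
      funext i
      simp only [Pi.sub_apply, Pi.smul_apply, smul_eq_mul, Pi.zero_apply]
      field_simp
      ring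
    refine le_trans (le_of_eq ?_) zero_le
    refine Eq.trans (congrArg _ h) ?_
    exact pow_eq_zero_iff two_ne_zero |>.1 (S.nrm_sq_zero α)
  · refine S.nrm_sq_mul_le α (fun i => ?_) x
    have h1 := S.gain_mul_weight_nonneg (j + 1) i
    have h2 := S.gain_mul_weight_le (Nat.le_add_left 1 j) i
    refine pow_le_one₀ (by positivity) ?_
    calc (j : ℝ) * (S.gain (j + 1) i * S.weight i) ≤ (j + 1 : ℕ) * ((j + 1 : ℕ) : ℝ)⁻¹ := by
          gcongr
          exact Nat.le_succ j
      _ = 1 := mul_inv_cancel₀ (by positivity)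

/-! ### Summable weights -/

variable {α} {β c : ℝ}

/-- Comparison with the series of `i^(-2αβ)`. -/
theorem summable_rpow (hα : 0 < α) (hαβ : 1 < 2 * α * β)
    (hs : ∀ i : ℕ, S.s i ≤ c * ((i : ℝ) + 1) ^ (-β)) : Summable fun i => S.s i ^ (2 * α) := by
  have hc : 0 ≤ c := by simpa using (S.s_pos 0).le.trans (hs 0)
  have h : Summable fun i : ℕ => c ^ (2 * α) * ((i : ℝ) + 1) ^ (-(2 * α * β)) := by
    refine Summable.mul_left _ ?_
    have := (summable_nat_add_iff 1).2 (Real.summable_nat_rpow.2 (neg_lt_neg hαβ))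
    simpa using this
  refine h.of_nonneg_of_le (fun i => Real.rpow_nonneg (S.s_pos i).le _) fun i => ?_
  have hi : (0 : ℝ) ≤ (i : ℝ) + 1 := by positivity
  refine (Real.rpow_le_rpow (S.s_pos i).le (hs i) (by positivity)).trans (le_of_eq ?_)
  rw [Real.mul_rpow hc (Real.rpow_nonneg hi _), ← Real.rpow_mul hi]
  congr 2
  ring

theorem postVar_le_one (j : ℕ) (i : ℕ ⊕ P) : S.postVar j i ≤ 1 := by
  rw [postVar, div_le_one (by positivity)]
  exact le_add_of_nonneg_right (by positivity)

theorem summable_rpow_mul_postVar (h : Summable fun i => S.s i ^ (2 * α)) (j : ℕ) :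
    Summable fun i => S.s i ^ (2 * α) * S.postVar j (Sum.inl i) :=
  h.of_nonneg_of_le
    (fun i => mul_nonneg (Real.rpow_nonneg (S.s_pos i).le _) (S.postVar_pos _ _).le)
    fun i => mul_le_of_le_one_right (Real.rpow_nonneg (S.s_pos i).le _) (S.postVar_le_one _ _)

theorem radiusSq_eq_ofReal (hα : 0 < α) (h : Summable fun i => S.s i ^ (2 * α)) (j : ℕ) :
    (S.model α).radiusSq j
      = ENNReal.ofReal (∑' i : ℕ, S.s i ^ (2 * α) * S.postVar j (Sum.inl i)) := by
  rw [S.radiusSq_eq_tsum_nat hα, ENNReal.ofReal_tsum_of_nonneg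
    (fun i => mul_nonneg (Real.rpow_nonneg (S.s_pos i).le _) (S.postVar_pos _ _).le)
    (S.summable_rpow_mul_postVar h j)]

/-- Dominated convergence: every posterior variance tends to zero, and the weights dominate. -/
theorem tendsto_radiusSq (hα : 0 < α) (h : Summable fun i => S.s i ^ (2 * α)) :
    Tendsto (S.model α).radiusSq atTop (𝓝 0) := by
  have h1 : Tendsto (fun j => ∑' i : ℕ, S.s i ^ (2 * α) * S.postVar j (Sum.inl i)) atTop
      (𝓝 (∑' _ : ℕ, (0 : ℝ))) := by
    refine tendsto_tsum_of_dominated_convergence h (fun i => ?_) (.of_forall fun j i => ?_)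
    · have := (S.tendsto_postVar i).const_mul (S.s i ^ (2 * α))
      rwa [mul_zero] at this
    · have h0 : 0 ≤ S.s i ^ (2 * α) := Real.rpow_nonneg (S.s_pos i).le _
      rw [Real.norm_of_nonneg (mul_nonneg h0 (S.postVar_pos _ _).le)]
      exact mul_le_of_le_one_right h0 (S.postVar_le_one _ _)
  have h2 := ENNReal.tendsto_ofReal h1
  rw [tsum_zero, ENNReal.ofReal_zero] at h2
  exact h2.congr fun j => (S.radiusSq_eq_ofReal hα h j).symm

theorem exists_forall_inv_sq_le_radiusSq (hα : 0 < α) :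
    ∃ n₀ : ℕ, ∀ j, n₀ ≤ j → ENNReal.ofReal (((j : ℝ)⁻¹) ^ 2) ≤ (S.model α).radiusSq j := by
  have hd : 0 < S.s 0 ^ (2 * α) := Real.rpow_pos_of_pos (S.s_pos 0) _
  -- The leading coordinate alone suffices, as its variance decays only like `1 / j`. The threshold
  -- gives `1 + s₀² ≤ j s₀^(2α)`.
  obtain ⟨n₀, hn₀⟩ := exists_nat_ge ((1 + S.s 0 ^ 2) / S.s 0 ^ (2 * α))
  refine ⟨n₀ + 1, fun j hj => ?_⟩
  rw [S.radiusSq_eq_tsum_nat hα]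
  refine le_trans (ENNReal.ofReal_le_ofReal ?_) (ENNReal.le_tsum 0)
  have hj1 : (1 : ℝ) ≤ j := by exact_mod_cast (Nat.le_add_left 1 n₀).trans hj
  have hj2 : (n₀ : ℝ) ≤ j := by exact_mod_cast (Nat.le_succ n₀).trans hj
  rw [div_le_iff₀ hd] at hn₀
  rw [postVar, weight_inl, mul_one_div, inv_pow, ← one_div,
    div_le_div_iff₀ (by positivity) (by positivity)]
  nlinarith [mul_le_mul_of_nonneg_right hj2 hd.le, sq_nonneg (S.s 0)]

theorem exists_regularity (hα : 0 < α) (h : Summable fun i => S.s i ^ (2 * α)) :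
    ∃ n₀ : ℕ, ∀ n, n₀ ≤ n → ∀ (s : ℝ) (ν : ℕ → ℝ≥0),
      (S.model α).Regularity n (fun j => (j : ℝ)⁻¹) s 0 ν := by
  obtain ⟨n₀, hn₀⟩ := S.exists_forall_inv_sq_le_radiusSq hα
  refine ⟨n₀, fun n hn s ν => ⟨fun j hj => ⟨?_, hn₀ j (hn.trans hj)⟩, S.tendsto_radiusSq hα h, ?_, ?_⟩⟩
  · rw [excessSq_eq_zero]
    exact zero_le
  · intro j k _
    simp only [excessSq_eq_zero, le_refl]
  · rw [ENNReal.ofReal_zero, zero_mul]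
    exact zero_le

end SingularSystem

end

/-! ### Assembly of the claims -/

theorem mainTheorem5 :
    ∃ C : ℝ≥0, ∀ (H : Type*) (Z : Type*)
      [NormedAddCommGroup H] [InnerProductSpace ℝ H] [CompleteSpace H]
      [NormedAddCommGroup Z] [InnerProductSpace ℝ Z] [CompleteSpace Z]
      (A : H →L[ℝ] Z) (P : Type*) (Q : Type*) [Countable P] [Countable Q]
      (S : SingularSystem A P Q) (α β : ℝ),
      1 / 2 < β →
      (∃ c₁ c₂ : ℝ, 0 < c₁ ∧ 0 < c₂ ∧
        ∀ i : ℕ, c₁ * ((i : ℝ) + 1) ^ (-β) ≤ S.s i ∧ S.s i ≤ c₂ * ((i : ℝ) + 1) ^ (-β)) →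
      -- the algorithm reproduces the posterior mean, and its excess error is zero
      (∀ j, (∀ᵐ z ∂(S.model α).dataLaw j, (S.model α).estimate j z = (S.model α).postMean j z) ∧
        (S.model α).risk j = (S.model α).radiusSq j ∧ (S.model α).excessSq j = 0) ∧
      -- the assumptions
      (∀ (n : ℕ) (N : ℕ∞) (δ ι s : ℝ) (ν : ℕ → ℝ≥0), 1 ≤ n → 0 < δ → 0 < ι → ι ≤ 1 →
        0 < s → s < min δ ι → Tendsto ν atTop (𝓝 0) →
        (S.model α).ApproxMartingale n δ ∧
        (S.model α).StabilityI n N (fun j => (j : ℝ)⁻¹) ι 1 1 1 ∧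
        (S.model α).Efficiency n N δ ι s ν ∧
        (S.model α).StabilityII (fun j => (j : ℝ)⁻¹) 0 1) ∧
      (1 < 2 * α * β →
        (∀ j, 1 ≤ j → (S.model α).radiusSq j < ∞) ∧
        ∃ n₀ : ℕ, ∀ n, n₀ ≤ n → ∀ (s : ℝ) (ν : ℕ → ℝ≥0),
          (S.model α).Regularity n (fun j => (j : ℝ)⁻¹) s 0 ν) ∧
      -- the bound for the martingale posterior truncated at `N`
      (∀ n N : ℕ, 1 ≤ n → n ≤ N →
        (S.model α).meanDistSq n ((S.model α).mpLaw n N)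
          ≤ C * ((S.model α).radiusSq n / n) + (S.model α).radiusSq N) ∧
      -- the untruncated martingale posterior exists and satisfies the bound
      (1 < 2 * α * β → ∀ n : ℕ, 1 ≤ n →
        (∀ θ, ∀ᵐ x ∂(S.model α).mpPath n θ,
          Tendsto (fun k => (S.model α).nrm (x k - MPModel.pathLimit x)) atTop (𝓝 0)) ∧
        (S.model α).meanDistSq n ((S.model α).mpLawInf n)
          ≤ C * ((S.model α).radiusSq n / n)) := by
  refine ⟨1, ?_⟩
  intro H Z _ _ _ _ _ _ A P Q _ _ S α β hβ ⟨c₁, c₂, _, _, hc⟩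
  -- As `β > 0`, a nonpositive `α` would make the product nonpositive.
  have hpos : 1 < 2 * α * β → 0 < α := fun h => by
    by_contra hα
    nlinarith [mul_nonneg (neg_nonneg.2 (not_lt.1 hα)) (one_half_pos.le.trans hβ.le)]
  have hsum : 1 < 2 * α * β → Summable fun i => S.s i ^ (2 * α) := fun h =>
    S.summable_rpow (hpos h) h fun i => (hc i).2
  simp only [ENNReal.coe_one, one_mul]
  refine ⟨fun j => ⟨S.postMean_ae_eq α j, S.risk_eq α j, S.excessSq_eq_zero α j⟩, ?_, ?_, ?_, ?_⟩
  · intro n N δ ι s ν hn hδ hι hι' hs hs' hν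
    exact ⟨S.approxMartingale α hn hδ, S.stabilityI α hn N hι hι',
      S.efficiency α n N hs hs' hν, S.stabilityII α⟩
  · intro h
    refine ⟨fun j _ => ?_, S.exists_regularity (hpos h) (hsum h)⟩
    rw [S.radiusSq_eq_ofReal (hpos h) (hsum h)]
    exact ENNReal.ofReal_lt_top
  · intro n N hn hnN
    exact S.meanDistSq_mpLaw_le α hn hnN
  · intro h n hn
    exact ⟨S.ae_tendsto_nrm_path (hpos h) hn (S.tendsto_radiusSq (hpos h) (hsum h)),
      S.meanDistSq_mpLawInf_le (hpos h) hn⟩
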